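/- Let $G=(V,E)$ be a finite connected simple graph with root $r\in V$ and $n=|V\setminus\{r\}|\ge 1$ non-root vertices, with edge lengths $\lambda_e>0$ $(e\in E)$ and vertex weights $p_v\ge 0$ $(v\in V)$ with $p_r=0$ (for instance, probabilities with $\sum_v p_v=1$). Let $\mathcal T(G)$ be the set of subtrees of $G$ that contain $r$. For $T\in\mathcal T(G)$ with vertex set $V[T]$ and edge set $E[T]$ put $p(T)=\sum_{v\in V[T]}p_v$, $\lambda(T)=\sum_{e\in E[T]}\lambda_e$ and, if $\lambda(T)>0$, $\rho(T)=p(T)/\lambda(T)$. Let $\rho^\star=\max\{\rho(T):T\in\mathcal T(G),\ \lambda(T)>0\}$. *Goemans–Williamson (GW) algorithm*, for edge costs $(c_e)$ and penalties $(\pi_v)$. Start with $F=\emptyset$, the components $\{v\}$, $v\in V$, of which all but $\{r\}$ are active, all values $w(\{v\})=d(v)=0$, and all vertices unlabelled. While some component is active: for an edge $e=\{i,j\}$ joining two distinct components, of which $a\in\{1,2\}$ are active, let its event time be $(c_e-d(i)-d(j))/a$; for an active component $C$ let its event time be $\sum_{v\in C}\pi_v-w(C)$. Let $t$ be the smallest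 event time, and choose any event attaining it. Increase $w(C)$ by $t$ for each active component $C$, and $d(v)$ by $t$ for each vertex $v$ of an active component. If the chosen event is a component $C$, make it inactive and give the label $C$ to all its unlabelled vertices. If it is an edge $e$ between $C_1$ and $C_2$, add $e$ to $F$ and replace $C_1,C_2$ by $C_1\cup C_2$, with $w(C_1\cup C_2)=w(C_1)+w(C_2)$, which is active if and only if it does not contain $r$. When no component is active, remove as many edges as possible from $F$ such that, in the remaining edge set, (1) every unlabelled vertex is connected to $r$, and (2) if a vertex with label $C$ is connected to $r$, then so is every vertex with a label $C'\supseteq C$. Output the tree formed by $r$ and the remaining edges. *Parametric search*, for a constant $\varepsilon>0$. 1. Take an arbitrary $T^{s}\in\mathcal T(G)$ with $\lambda(T^s)>0$ and set $\alpha\gets(2-\frac1n)\,p(T^{s})/\lambda(T^{s})$ and $\beta\gets\max\{p_v/\lambda_{\{v,w\}}:\{v,w\}\in E\}$. 2. While $\beta>(1+\varepsilon)\alpha$: set $\rho\gets(\alpha+\beta)/2$; let $T$ be an output of the GW algorithm on $G$ with edge costs $(\rho\lambda_e)_{e\in E}$ and penalties $(p_v)_{v\in V}$; if $(2-\frac1n)p(T)\le\rho\lambda(T)$,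 set $\beta\gets\rho$; otherwise set $\alpha\gets(2-\frac1n)\rho(T)$ and $T^{s}\gets T$. 3. Return $T^{s}$. Then for every $\varepsilon>0$, every execution of the parametric search (for every choice of the initial tree and every way of breaking ties in the GW algorithm) terminates, as does every call of the GW algorithm in it, and the tree $T^{s}$ that it returns belongs to $\mathcal T(G)$, has $\lambda(T^s)>0$, and satisfies $$\rho^\star\le(1+\varepsilon)\left(2-\tfrac1n\right)\rho(T^{s}).$$ -/

import Mathlib

namespace MDSP

section Trees

variable {V : Type*} {G : SimpleGraph V}

/-- The subtrees of `G` with root `r`. -/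
def IsRootedSubtree (r : V) (T : G.Subgraph) : Prop :=
  r ∈ T.verts ∧ T.coe.IsTree

/-- `p(T)`, the total weight of the vertices of `T`. -/
noncomputable def weight (p : V → ℝ) (T : G.Subgraph) : ℝ :=
  ∑ᶠ v ∈ T.verts, p v

/-- `λ(T)`, the total length of the edges of `T`. -/
noncomputable def length (len : Sym2 V → ℝ) (T : G.Subgraph) : ℝ :=
  ∑ᶠ e ∈ T.edgeSet, len e

/-- The search density `ρ(T) = p(T) / λ(T)`; only meaningful if `0 < λ(T)`. -/
noncomputable def density (p : V → ℝ) (len : Sym2 V → ℝ) (T : G.Subgraph) : ℝ :=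
  weight p T / length len T

/-- The densities of all rooted subtrees of positive length. -/
def densities (G : SimpleGraph V) (r : V) (p : V → ℝ) (len : Sym2 V → ℝ) : Set ℝ :=
  {x | ∃ T : G.Subgraph, IsRootedSubtree r T ∧ 0 < length len T ∧ x = density p len T}

end Trees

section Executions

/-- All executions of the nondeterministic program `step` from `s₀` end, after finitely many
steps, in a state satisfying the exit condition `done`: none gets stuck, none is infinite. -/
def AlwaysTerminates {σ : Type*} (step : σ → σ → Prop) (done : σ → Prop) (s₀ : σ) : Prop :=
  (∀ s, Relation.ReflTransGen step s₀ s → done s ∨ ∃ s', step s s') ∧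
  ¬ ∃ run : ℕ → σ, run 0 = s₀ ∧ ∀ k, step (run k) (run (k + 1))

end Executions

/-! ### The Goemans–Williamson algorithm for the rooted prize-collecting Steiner tree problem -/

section GoemansWilliamson

variable {V : Type*} [Fintype V] [DecidableEq V]

/-- The variables of the growth phase. -/
structure GWState (V : Type*) where
  /-- the current components, a partition of the vertex set -/
  comps : Finset (Finset V)
  /-- the components that are active -/
  active : Finset (Finset V)
  /-- the total dual value accumulated inside a component -/
  w : Finset V → ℝ
  /-- the total dual value of the sets containing a vertex -/
  d : V → ℝ
  /-- the edges selected so far -/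
  F : Finset (Sym2 V)
  /-- the labels of the vertices, `none` for an unlabelled vertex -/
  label : V → Option (Finset V)

namespace GWState

/-- Every vertex is a component; all components but the one of the root are active. -/
def init (r : V) : GWState V where
  comps := Finset.univ.image fun v => {v}
  active := (Finset.univ.erase r).image fun v => {v}
  w := fun _ => 0
  d := fun _ => 0
  F := ∅
  label := fun _ => none

/-- The growth rate of a component: `1` if it is active and `0` otherwise. -/
def rate (s : GWState V) (C : Finset V) : ℝ :=
  if C ∈ s.active then 1 else 0

/-- The edge `{i, j}` of `G` joins the distinct components `P ∋ i` and `Q ∋ j`, at least one of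
which is active. -/
def Joins (G : SimpleGraph V) (s : GWState V) (i j : V) (P Q : Finset V) : Prop :=
  G.Adj i j ∧ P ∈ s.comps ∧ Q ∈ s.comps ∧ i ∈ P ∧ j ∈ Q ∧ P ≠ Q ∧
    (P ∈ s.active ∨ Q ∈ s.active)

/-- The time until the edge `{i, j}` between the components `P` and `Q` becomes tight. -/
noncomputable def edgeTime (c : Sym2 V → ℝ) (s : GWState V) (i j : V) (P Q : Finset V) : ℝ :=
  (c s(i, j) - s.d i - s.d j) / (s.rate P + s.rate Q)

/-- The time until the penalty of the active component `C` is used up. -/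
def compTime (π : V → ℝ) (s : GWState V) (C : Finset V) : ℝ :=
  (∑ v ∈ C, π v) - s.w C

/-- No edge becomes tight and no penalty is used up before time `t`. -/
def NoEarlierEvent (G : SimpleGraph V) (c : Sym2 V → ℝ) (π : V → ℝ) (s : GWState V)
    (t : ℝ) : Prop :=
  (∀ i j P Q, s.Joins G i j P Q → t ≤ s.edgeTime c i j P Q) ∧
  (∀ C ∈ s.active, t ≤ s.compTime π C)

/-- Grow all active components uniformly by `t`. -/
noncomputable def grow (s : GWState V) (t : ℝ) : GWState V :=
  { s with
    w := fun C => s.w C + t * s.rate C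
    d := fun v => if ∃ C ∈ s.active, v ∈ C then s.d v + t else s.d v }

/-- Deactivate `C` and give the label `C` to its unlabelled vertices. -/
def deactivate (s : GWState V) (C : Finset V) : GWState V :=
  { s with
    active := s.active.erase C
    label := fun v => if v ∈ C ∧ s.label v = none then some C else s.label v }

/-- Select the edge `e` and merge `P` and `Q`; the new component is active unless it contains
the root. -/
def merge (r : V) (s : GWState V) (e : Sym2 V) (P Q : Finset V) : GWState V :=
  { s with
    comps := insert (P ∪ Q) ((s.comps.erase P).erase Q)
    active := if r ∈ P ∪ Q then (s.active.erase P).erase Q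
      else insert (P ∪ Q) ((s.active.erase P).erase Q)
    w := Function.update s.w (P ∪ Q) (s.w P + s.w Q)
    F := insert e s.F }

end GWState

/-- One iteration of the growth phase, with edge costs `c`, penalties `π` and root `r`: grow until
the next event, then perform it. Ties between events are broken arbitrarily. -/
inductive GWStep (G : SimpleGraph V) (r : V) (c : Sym2 V → ℝ) (π : V → ℝ) :
    GWState V → GWState V → Prop
  | deactivate (s : GWState V) (C : Finset V) (hC : C ∈ s.active)
      (hmin : s.NoEarlierEvent G c π (s.compTime π C)) :
      GWStep G r c π s ((s.grow (s.compTime π C)).deactivate C)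
  | merge (s : GWState V) (i j : V) (P Q : Finset V) (h : s.Joins G i j P Q)
      (hmin : s.NoEarlierEvent G c π (s.edgeTime c i j P Q)) :
      GWStep G r c π s ((s.grow (s.edgeTime c i j P Q)).merge r s(i, j) P Q)

/-- `v` is connected to the root by edges in `F`. -/
def ConnectedToRoot (r : V) (F : Finset (Sym2 V)) (v : V) : Prop :=
  (SimpleGraph.fromEdgeSet (F : Set (Sym2 V))).Reachable r v

/-- The requirements on the edge set that is kept in the pruning phase: every unlabelled vertex is
connected to the root, and if a vertex with label `C` is connected to the root, then so is every
vertex with a label `C' ⊇ C`. -/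
def PruneFeasible (r : V) (s : GWState V) (F' : Finset (Sym2 V)) : Prop :=
  F' ⊆ s.F ∧
  (∀ v, s.label v = none → ConnectedToRoot r F' v) ∧
  (∀ v u C C', s.label v = some C → s.label u = some C' → C ⊆ C' →
    ConnectedToRoot r F' v → ConnectedToRoot r F' u)

/-- `T` is a possible output of the Goemans–Williamson algorithm: run the growth phase until no
component is active, then remove as many of the selected edges as possible. -/
def IsGWOutput (G : SimpleGraph V) (r : V) (c : Sym2 V → ℝ) (π : V → ℝ)
    (T : G.Subgraph) : Prop :=
  ∃ (s : GWState V) (F' : Finset (Sym2 V)),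
    Relation.ReflTransGen (GWStep G r c π) (GWState.init r) s ∧ s.active = ∅ ∧
    PruneFeasible r s F' ∧ (∀ F'', PruneFeasible r s F'' → F'.card ≤ F''.card) ∧
    T.verts = {v | ConnectedToRoot r F' v} ∧ T.edgeSet = (F' : Set (Sym2 V))

end GoemansWilliamson

/-! ### The parametric search -/

section ParametricSearch

variable {V : Type*} [Fintype V] [DecidableEq V]

/-- The factor `2 - 1/n`, where `n` is the number of non-root vertices. -/
noncomputable def factor (r : V) : ℝ :=
  2 - 1 / ((Finset.univ.erase r).card : ℝ)

/-- The variables of the parametric search. -/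
structure SearchState (G : SimpleGraph V) where
  α : ℝ
  β : ℝ
  tree : G.Subgraph

variable {G : SimpleGraph V}

/-- The guess `ρ = (α + β) / 2`. -/
noncomputable def SearchState.guess (s : SearchState G) : ℝ :=
  (s.α + s.β) / 2

/-- The search starts from an arbitrary rooted subtree (of positive length, so that its density
is defined). -/
def SearchInitial (r : V) (p : V → ℝ) (len : Sym2 V → ℝ) (s : SearchState G) : Prop :=
  IsRootedSubtree r s.tree ∧ 0 < length len s.tree ∧
  s.α = factor r * (weight p s.tree / length len s.tree) ∧
  IsGreatest {x | ∃ v w, G.Adj v w ∧ x = p v / len s(v, w)} s.β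

/-- The exit condition of the while loop. -/
def SearchDone (ε : ℝ) (s : SearchState G) : Prop :=
  ¬ (1 + ε) * s.α < s.β

/-- One iteration of the while loop. -/
def SearchStep (r : V) (p : V → ℝ) (len : Sym2 V → ℝ) (ε : ℝ) (s s' : SearchState G) : Prop :=
  (1 + ε) * s.α < s.β ∧
  ∃ T : G.Subgraph, IsGWOutput G r (fun e => s.guess * len e) p T ∧
    ((factor r * weight p T ≤ s.guess * length len T ∧
        s' = { α := s.α, β := s.guess, tree := s.tree }) ∨
     (s.guess * length len T < factor r * weight p T ∧
        s' = { α := factor r * density p len T, β := s.β, tree := T }))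

/-- The states that occur at the beginning of an iteration in some execution of the search. -/
def SearchReachable (r : V) (p : V → ℝ) (len : Sym2 V → ℝ) (ε : ℝ) (s : SearchState G) : Prop :=
  ∃ s₀ : SearchState G, SearchInitial r p len s₀ ∧
    Relation.ReflTransGen (SearchStep r p len ε) s₀ s

/-- `T` is returned by some execution of the parametric search. -/
def SearchReturns (r : V) (p : V → ℝ) (len : Sym2 V → ℝ) (ε : ℝ) (T : G.Subgraph) : Prop :=
  ∃ s : SearchState G, SearchReachable r p len ε s ∧ SearchDone ε s ∧ s.tree = T

end ParametricSearch

end MDSP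

set_option linter.unusedSectionVars false

/-! The growth phase builds a dual solution `y`: while a component is active, its variable rises at
rate 1. `DualInvariant` records that `y` is feasible for the edge costs (mass crossing an edge) and
the penalties (mass inside a vertex set), that selected edges are tight, and that labels are tight
sets. Four facts give the Lagrangian-preserving guarantee `gw_guarantee`. (a) Since kept edges are
tight, the output `T` costs the sum of `y S` times the number of kept edges leaving `S`. (b) At
every moment the active components meeting `T` have average degree at most `2 - 1/n` in the kept
edges (`sum_active_cutCard_le`); integrating over time bounds the cost by `2 - 1/n` times the mass
of the sets meeting `T` (`exists_dual_of_run`). (c) The sets avoiding `T` have mass exactly the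
penalty outside `T`, because that region is a union of tight labels (`mass_compl_eq`). (d) By weak
duality any connected competitor `T'` through the root pays for all of `y` (`mass_univ_le`).
Together, `c(T) - (2 - 1/n) π(T) ≤ (2 - 1/n) (c(T') - π(T'))`. With costs `ρ λ`, the test in the
search has two outcomes. Either the left side is nonnegative, so no competitor has density above `ρ`
and `β` may drop to `ρ`; or `T` itself satisfies `ρ < (2 - 1/n) ρ(T)`, so `α` may rise. Thus `β`
always bounds `ρ⋆` and `α` is `2 - 1/n` times the density of the stored tree. The exit condition
then gives the bound. The gap `β - α` halves in each round, so an infinite run would force `β` to 0,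
although `β` bounds the density of the whole graph. -/

namespace MDSP

/-! ### Set functions summed over families of vertex sets. -/

section Mass

variable {V : Type*} [Fintype V] [DecidableEq V]

/-- The total value of `y` on the family `A` of vertex sets. -/
noncomputable def mass (y : Finset V → ℝ) (A : Set (Finset V)) : ℝ :=
  ∑ S, A.indicator y S

/-- The edge `e` has exactly one endpoint in `S`. -/
def Crosses (S : Finset V) (e : Sym2 V) : Prop :=
  ∃ i j, e = s(i, j) ∧ i ∈ S ∧ j ∉ S

theorem crosses_mk {S : Finset V} {i j : V} :
    Crosses S s(i, j) ↔ (i ∈ S ∧ j ∉ S) ∨ (j ∈ S ∧ i ∉ S) := by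
  constructor
  · rintro ⟨a, b, h, ha, hb⟩
    rcases Sym2.eq_iff.1 h with ⟨rfl, rfl⟩ | ⟨rfl, rfl⟩
    · exact Or.inl ⟨ha, hb⟩
    · exact Or.inr ⟨ha, hb⟩
  · rintro (⟨h, h'⟩ | ⟨h, h'⟩)
    · exact ⟨i, j, rfl, h, h'⟩
    · exact ⟨j, i, Sym2.eq_swap, h, h'⟩

theorem mass_add_mul (y z : Finset V → ℝ) (t : ℝ) (A : Set (Finset V)) :
    mass (fun S => y S + t * z S) A = mass y A + t * mass z A := by
  classical
  simp only [mass, Finset.mul_sum, ← Finset.sum_add_distrib]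
  refine Finset.sum_congr rfl fun S _ => ?_
  by_cases hS : S ∈ A <;> simp [hS]

theorem mass_eq_zero {y : Finset V → ℝ} {A : Set (Finset V)} (h : ∀ S ∈ A, y S = 0) :
    mass y A = 0 := by
  refine Finset.sum_eq_zero fun S _ => ?_
  by_cases hS : S ∈ A
  · simp [hS, h S hS]
  · simp [hS]

theorem mass_eq_single {y : Finset V → ℝ} {A : Set (Finset V)} {P : Finset V} (hP : P ∈ A)
    (h : ∀ S ∈ A, y S ≠ 0 → S = P) : mass y A = y P := by
  rw [mass, Finset.sum_eq_single P, Set.indicator_of_mem hP]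
  · intro S _ hS
    by_cases hA : S ∈ A
    · rw [Set.indicator_of_mem hA]
      by_contra h0
      exact hS (h S hA h0)
    · simp [hA]
  · simp

/-- Sets of equality in a packing constraint are closed under unions. -/
theorem tight_union {y : Finset V → ℝ} (hy : ∀ S, 0 ≤ y S) {π : V → ℝ}
    (pack : ∀ U : Finset V, mass y {S | S ⊆ U} ≤ ∑ v ∈ U, π v) {A B : Finset V}
    (hA : mass y {S | S ⊆ A} = ∑ v ∈ A, π v) (hB : mass y {S | S ⊆ B} = ∑ v ∈ B, π v) :
    mass y {S | S ⊆ A ∪ B} = ∑ v ∈ A ∪ B, π v := by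
  classical
  have h1 := Finset.sum_union_inter (s₁ := A) (s₂ := B) (f := π)
  have h2 := pack (A ∪ B)
  have h3 := pack (A ∩ B)
  -- Uncrossing: the mass inside a set is supermodular, whereas the penalty is modular.
  have h4 : mass y {S | S ⊆ A} + mass y {S | S ⊆ B} ≤
      mass y {S | S ⊆ A ∪ B} + mass y {S | S ⊆ A ∩ B} := by
    simp only [mass, ← Finset.sum_add_distrib]
    refine Finset.sum_le_sum fun S _ => ?_
    have := hy S
    have hu1 : S ⊆ A → S ⊆ A ∪ B := fun h => h.trans Finset.subset_union_left
    have hu2 : S ⊆ B → S ⊆ A ∪ B := fun h => h.trans Finset.subset_union_right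
    simp only [Set.indicator_apply, Set.mem_ofPred_eq, Finset.subset_inter_iff]
    split_ifs <;> first | linarith | tauto
  linarith

end Mass

/-! ### The dual solution and its feasibility during growth and deactivation. -/

section Invariant

variable {V : Type*} [Fintype V] [DecidableEq V]

/-- The invariant of the growth phase; `y` is the dual solution constructed so far. -/
structure DualInvariant (G : SimpleGraph V) (r : V) (c : Sym2 V → ℝ) (π : V → ℝ)
    (s : GWState V) (y : Finset V → ℝ) : Prop where
  nonempty : ∀ C ∈ s.comps, C.Nonempty
  eq_of_mem : ∀ C ∈ s.comps, ∀ D ∈ s.comps, ∀ v, v ∈ C → v ∈ D → C = D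
  cover : ∀ v, ∃ C ∈ s.comps, v ∈ C
  active_sub : s.active ⊆ s.comps
  root_notMem : ∀ C ∈ s.active, r ∉ C
  y_nonneg : ∀ S, 0 ≤ y S
  y_nonempty : ∀ S, y S ≠ 0 → S.Nonempty
  y_root : ∀ S, y S ≠ 0 → r ∉ S
  y_sub : ∀ S, y S ≠ 0 → ∃ C ∈ s.comps, S ⊆ C
  w_eq : ∀ C ∈ s.comps, s.w C = mass y {S | S ⊆ C}
  d_eq : ∀ v, s.d v = mass y {S | v ∈ S}
  packing : ∀ U : Finset V, mass y {S | S ⊆ U} ≤ ∑ v ∈ U, π v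
  edge_le : ∀ e ∈ G.edgeSet, mass y {S | Crosses S e} ≤ c e
  F_edge : ∀ e ∈ s.F, e ∈ G.edgeSet
  F_inside : ∀ e ∈ s.F, ∀ C ∈ s.comps, ¬ Crosses C e
  F_tight : ∀ e ∈ s.F, c e = mass y {S | Crosses S e}
  reach : ∀ C ∈ s.comps, ∀ u ∈ C, ∀ v ∈ C,
    (SimpleGraph.fromEdgeSet (s.F : Set (Sym2 V))).Reachable u v
  label_mem : ∀ v C, s.label v = some C → v ∈ C
  label_tight : ∀ v C, s.label v = some C → mass y {S | S ⊆ C} = ∑ v ∈ C, π v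
  label_sub : ∀ v C, s.label v = some C → ∀ D ∈ s.comps, v ∈ D → C ⊆ D
  label_notMem : ∀ v C, s.label v = some C → C ∉ s.active
  label_down : ∀ v C, s.label v = some C → ∀ u ∈ C, ∃ D ⊆ C, s.label u = some D
  label_inactive : ∀ C ∈ s.comps, C ∉ s.active → r ∉ C → ∀ v ∈ C, s.label v ≠ none

namespace DualInvariant

variable {G : SimpleGraph V} {r : V} {c : Sym2 V → ℝ} {π : V → ℝ} {s : GWState V}
  {y : Finset V → ℝ}

theorem init (hc : ∀ e ∈ G.edgeSet, 0 ≤ c e) (hπ : ∀ v, 0 ≤ π v) :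
    DualInvariant G r c π (GWState.init r) (fun _ => 0) := by
  have h0 : ∀ A : Set (Finset V), mass (fun _ => (0 : ℝ)) A = 0 := fun A =>
    mass_eq_zero fun _ _ => rfl
  constructor <;> try simp only [h0, GWState.init]
  case packing => exact fun U => Finset.sum_nonneg fun v _ => hπ v
  case edge_le => exact hc
  case active_sub => exact Finset.image_subset_image (Finset.erase_subset _ _)
  case label_inactive =>
    intro C hC hC' hr
    obtain ⟨v, -, rfl⟩ := Finset.mem_image.1 hC
    refine (hC' (Finset.mem_image_of_mem _ (Finset.mem_erase.2 ⟨?_, Finset.mem_univ v⟩))).elim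
    rintro rfl
    exact hr (Finset.mem_singleton_self v)
  all_goals try simp +contextual [eq_comm]

/-- Sets supported inside single components cannot contain both ends of an edge between two
components. This is why the algorithm can test tightness of an edge with `d i + d j`. -/
theorem crosses_eq (h : DualInvariant G r c π s y) {P Q : Finset V} {i j : V}
    (hP : P ∈ s.comps) (hQ : Q ∈ s.comps) (hi : i ∈ P) (hj : j ∈ Q) (hPQ : P ≠ Q)
    {z : Finset V → ℝ} (hz : ∀ S, z S ≠ 0 → ∃ C ∈ s.comps, S ⊆ C) :
    mass z {S | Crosses S s(i, j)} = mass z {S | i ∈ S} + mass z {S | j ∈ S} := by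
  classical
  simp only [mass, ← Finset.sum_add_distrib]
  refine Finset.sum_congr rfl fun S _ => ?_
  by_cases hS : z S = 0
  · simp [Set.indicator_apply, hS]
  · obtain ⟨C, hC, hSC⟩ := hz S hS
    have : ¬ (i ∈ S ∧ j ∈ S) := by
      rintro ⟨h1, h2⟩
      exact hPQ ((h.eq_of_mem P hP C hC i hi (hSC h1)).trans
        (h.eq_of_mem Q hQ C hC j hj (hSC h2)).symm)
    simp only [Set.indicator_apply, Set.mem_ofPred_eq, crosses_mk]
    by_cases h1 : i ∈ S <;> by_cases h2 : j ∈ S <;> simp_all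

theorem eq_of_mem_active (h : DualInvariant G r c π s y) {P : Finset V} {v : V}
    (hP : P ∈ s.comps) (hv : v ∈ P) {S : Finset V} (hvS : v ∈ S) (hS : s.rate S ≠ 0) :
    S = P := by
  have : S ∈ s.active := by
    by_contra h0
    exact hS (if_neg h0)
  exact h.eq_of_mem S (h.active_sub this) P hP v hvS hv

theorem rate_mass (h : DualInvariant G r c π s y) {P : Finset V} {v : V}
    (hP : P ∈ s.comps) (hv : v ∈ P) : mass s.rate {S | v ∈ S} = s.rate P :=
  mass_eq_single hv fun _ hS h0 => h.eq_of_mem_active hP hv hS h0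

theorem rate_ne_zero {S : Finset V} (hS : s.rate S ≠ 0) : S ∈ s.active := by
  by_contra h0
  exact hS (if_neg h0)

theorem rate_nonneg (S : Finset V) : 0 ≤ s.rate S := by
  unfold GWState.rate
  split_ifs <;> norm_num

/-- The mass inside `U` splits along the components. -/
theorem mass_split (h : DualInvariant G r c π s y) {z : Finset V → ℝ}
    (hz : ∀ S, z S ≠ 0 → ∃ C ∈ s.comps, S ⊆ C) (hz' : ∀ S, z S ≠ 0 → S.Nonempty)
    (U : Finset V) :
    mass z {S | S ⊆ U} = ∑ C ∈ s.comps, mass z {S | S ⊆ U ∩ C} := by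
  classical
  simp only [mass]
  rw [Finset.sum_comm]
  refine Finset.sum_congr rfl fun S _ => ?_
  by_cases hS : z S = 0
  · simp [Set.indicator_apply, hS]
  · obtain ⟨C, hC, hSC⟩ := hz S hS
    obtain ⟨v, hv⟩ := hz' S hS
    rw [Finset.sum_eq_single C]
    · simp [Set.indicator_apply, Finset.subset_inter_iff, hSC]
    · intro D hD hDC
      refine Set.indicator_of_notMem (fun hSD => hDC ?_) _
      exact h.eq_of_mem D hD C hC v (Finset.mem_inter.1 (hSD hv)).2 (hSC hv)
    · exact fun h0 => (h0 hC).elim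

theorem sum_split (h : DualInvariant G r c π s y) (f : V → ℝ) (U : Finset V) :
    ∑ v ∈ U, f v = ∑ C ∈ s.comps, ∑ v ∈ U ∩ C, f v := by
  classical
  simp only [← Finset.sum_ite_mem]
  rw [Finset.sum_comm]
  refine Finset.sum_congr rfl fun v _ => ?_
  obtain ⟨C, hC, hv⟩ := h.cover v
  rw [Finset.sum_eq_single C]
  · simp [hv]
  · intro D hD hDC
    exact if_neg fun hvD => hDC (h.eq_of_mem D hD C hC v hvD hv)
  · exact fun h0 => (h0 hC).elim

/-- Only constraints seen by an active component can tighten, and those are the ones limited by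
`NoEarlierEvent`. Selected edges and labels stay tight because no active component crosses such an
edge or lies inside a label. -/
theorem grow (h : DualInvariant G r c π s y) {t : ℝ} (ht : 0 ≤ t)
    (hmin : s.NoEarlierEvent G c π t) :
    DualInvariant G r c π (s.grow t) (fun S => y S + t * s.rate S) := by
  classical
  have hy' : ∀ S, y S + t * s.rate S ≠ 0 → y S ≠ 0 ∨ S ∈ s.active := by
    intro S hS
    by_contra! h0
    exact hS (by rw [h0.1, GWState.rate, if_neg h0.2]; ring)
  have hsub : ∀ S, y S + t * s.rate S ≠ 0 → ∃ C ∈ s.comps, S ⊆ C := by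
    intro S hS
    rcases hy' S hS with h0 | h0
    · exact h.y_sub S h0
    · exact ⟨S, h.active_sub h0, le_rfl⟩
  have hne : ∀ S, y S + t * s.rate S ≠ 0 → S.Nonempty := by
    intro S hS
    rcases hy' S hS with h0 | h0
    · exact h.y_nonempty S h0
    · exact h.nonempty S (h.active_sub h0)
  have hw : ∀ C ∈ s.comps, mass s.rate {S | S ⊆ C} = s.rate C := by
    intro C hC
    refine mass_eq_single (Finset.Subset.refl C) fun S hS h0 => ?_
    obtain ⟨v, hv⟩ := h.nonempty S (h.active_sub (rate_ne_zero h0))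
    exact h.eq_of_mem_active hC (hS hv) hv h0
  refine
    { nonempty := h.nonempty
      eq_of_mem := h.eq_of_mem
      cover := h.cover
      active_sub := h.active_sub
      root_notMem := h.root_notMem
      y_nonneg := fun S => add_nonneg (h.y_nonneg S) (mul_nonneg ht (rate_nonneg S))
      y_nonempty := hne
      y_root := ?_
      y_sub := hsub
      w_eq := ?_
      d_eq := ?_
      packing := ?_
      edge_le := ?_
      F_edge := h.F_edge
      F_inside := h.F_inside
      F_tight := ?_
      reach := h.reach
      label_mem := h.label_mem
      label_tight := ?_
      label_sub := h.label_sub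
      label_notMem := h.label_notMem
      label_down := h.label_down
      label_inactive := h.label_inactive }
  · intro S hS
    rcases hy' S hS with h0 | h0
    · exact h.y_root S h0
    · exact h.root_notMem S h0
  · intro C hC
    rw [mass_add_mul, hw C hC]
    simp [GWState.grow, h.w_eq C hC]
  · intro v
    obtain ⟨P, hP, hv⟩ := h.cover v
    rw [mass_add_mul, h.rate_mass hP hv, ← h.d_eq]
    have : (∃ C ∈ s.active, v ∈ C) ↔ P ∈ s.active := by
      constructor
      · rintro ⟨C, hC, hvC⟩
        exact h.eq_of_mem C (h.active_sub hC) P hP v hvC hv ▸ hC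
      · exact fun h0 => ⟨P, h0, hv⟩
    simp only [GWState.grow, this, GWState.rate]
    split_ifs <;> simp
  · intro U
    -- The packing constraint is checked one component at a time. The part of `U` in `C` gains mass
    -- only if `C` is active and lies entirely in `U`, and then the event time of `C` bounds the
    -- gain.
    rw [h.mass_split hsub hne, h.sum_split π]
    refine Finset.sum_le_sum fun C hC => ?_
    rw [mass_add_mul]
    by_cases hCU : C ∈ s.active ∧ C ⊆ U
    · rw [Finset.inter_eq_right.2 hCU.2, hw C hC, ← h.w_eq C hC]
      have := hmin.2 C hCU.1
      simp only [GWState.compTime] at this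
      simp only [GWState.rate, if_pos hCU.1]
      linarith
    · rw [mass_eq_zero (y := s.rate), mul_zero, add_zero]
      · exact h.packing _
      · intro S hS
        by_contra h0
        have hSa := rate_ne_zero h0
        obtain ⟨v, hv⟩ := h.nonempty S (h.active_sub hSa)
        have hSU : S ⊆ U ∩ C := hS
        have hSC := h.eq_of_mem S (h.active_sub hSa) C hC v hv (Finset.mem_inter.1 (hSU hv)).2
        subst hSC
        exact hCU ⟨hSa, fun x hx => (Finset.mem_inter.1 (hSU hx)).1⟩
  · intro e he
    induction e using Sym2.ind with
    | _ i j =>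
    obtain ⟨P, hP, hi⟩ := h.cover i
    obtain ⟨Q, hQ, hj⟩ := h.cover j
    by_cases hPQ : P ≠ Q ∧ (P ∈ s.active ∨ Q ∈ s.active)
    · rw [h.crosses_eq hP hQ hi hj hPQ.1 hsub, mass_add_mul, mass_add_mul, h.rate_mass hP hi,
        h.rate_mass hQ hj, ← h.d_eq, ← h.d_eq]
      have h1 := hmin.1 i j P Q ⟨he, hP, hQ, hi, hj, hPQ.1, hPQ.2⟩
      have h2 : 0 < s.rate P + s.rate Q := by
        rcases hPQ.2 with h0 | h0
        · have := rate_nonneg (s := s) Q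
          rw [GWState.rate, if_pos h0]; linarith
        · have := rate_nonneg (s := s) P
          rw [GWState.rate, GWState.rate, if_pos h0]
          rw [GWState.rate] at this; linarith
      rw [GWState.edgeTime, le_div_iff₀ h2] at h1
      linarith
    · rw [mass_add_mul, mass_eq_zero (y := s.rate), mul_zero, add_zero]
      · exact h.edge_le _ he
      · intro S hS
        by_contra h0
        rcases crosses_mk.1 hS with ⟨h1, h2⟩ | ⟨h1, h2⟩
        · obtain rfl := h.eq_of_mem_active hP hi h1 h0
          exact hPQ ⟨fun hE => h2 (hE ▸ hj), Or.inl (rate_ne_zero h0)⟩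
        · obtain rfl := h.eq_of_mem_active hQ hj h1 h0
          exact hPQ ⟨fun hE => h2 (hE ▸ hi), Or.inr (rate_ne_zero h0)⟩
  · intro e he
    rw [mass_add_mul, mass_eq_zero (y := s.rate), mul_zero, add_zero]
    · exact h.F_tight e he
    · intro S hS
      by_contra h0
      exact h.F_inside e he S (h.active_sub (rate_ne_zero h0)) hS
  · intro v C hv
    rw [mass_add_mul, mass_eq_zero (y := s.rate), mul_zero, add_zero]
    · exact h.label_tight v C hv
    · intro S hS
      by_contra h0
      have hSa := rate_ne_zero h0
      obtain ⟨u, hu⟩ := h.nonempty S (h.active_sub hSa)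
      obtain ⟨D, hD, hvD⟩ := h.cover v
      -- An active set inside the label `C` meets the component `D ⊇ C`, so it equals `D` and hence
      -- `C`; but labels are never active.
      have hCD := h.label_sub v C hv D hD hvD
      have hSC : S ⊆ C := hS
      have := h.eq_of_mem S (h.active_sub hSa) D hD u hu (hCD (hSC hu))
      subst this
      exact h.label_notMem v C hv (hCD.antisymm hSC ▸ hSa)

theorem deactivate (h : DualInvariant G r c π s y) {C : Finset V} (hC : C ∈ s.active)
    (ht : s.w C = ∑ v ∈ C, π v) : DualInvariant G r c π (s.deactivate C) y := by
  have hCc := h.active_sub hC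
  have hlab : ∀ v D, (s.deactivate C).label v = some D →
      s.label v = some D ∨ (v ∈ C ∧ s.label v = none ∧ D = C) := by
    intro v D hv
    simp only [GWState.deactivate] at hv
    split_ifs at hv with h0
    · exact Or.inr ⟨h0.1, h0.2, (Option.some.inj hv).symm⟩
    · exact Or.inl hv
  have hold : ∀ v D, s.label v = some D → (s.deactivate C).label v = some D := by
    intro v D hv
    simp [GWState.deactivate, hv]
  -- Vertices labelled earlier keep their label, which lies inside their component `C`; the others
  -- receive `C` itself.
  have hnew : ∀ v ∈ C, ∃ D ⊆ C, (s.deactivate C).label v = some D := by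
    intro v hv
    cases hl : s.label v with
    | none => exact ⟨C, le_rfl, by simp [GWState.deactivate, hl, hv]⟩
    | some D => exact ⟨D, h.label_sub v D hl C hCc hv, hold v D hl⟩
  refine
    { nonempty := h.nonempty
      eq_of_mem := h.eq_of_mem
      cover := h.cover
      active_sub := (Finset.erase_subset _ _).trans h.active_sub
      root_notMem := fun D hD => h.root_notMem D (Finset.mem_of_mem_erase hD)
      y_nonneg := h.y_nonneg
      y_nonempty := h.y_nonempty
      y_root := h.y_root
      y_sub := h.y_sub
      w_eq := h.w_eq
      d_eq := h.d_eq
      packing := h.packing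
      edge_le := h.edge_le
      F_edge := h.F_edge
      F_inside := h.F_inside
      F_tight := h.F_tight
      reach := h.reach
      label_mem := ?_
      label_tight := ?_
      label_sub := ?_
      label_notMem := ?_
      label_down := ?_
      label_inactive := ?_ }
  · intro v D hv
    rcases hlab v D hv with h0 | ⟨h0, -, rfl⟩
    · exact h.label_mem v D h0
    · exact h0
  · intro v D hv
    rcases hlab v D hv with h0 | ⟨h0, -, rfl⟩
    · exact h.label_tight v D h0
    · rw [← h.w_eq D hCc, ht]
  · intro v D hv E hE hvE
    rcases hlab v D hv with h0 | ⟨h0, -, rfl⟩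
    · exact h.label_sub v D h0 E hE hvE
    · exact (h.eq_of_mem D hCc E hE v h0 hvE).subset
  · intro v D hv hD
    rcases hlab v D hv with h0 | ⟨h0, -, rfl⟩
    · exact h.label_notMem v D h0 (Finset.mem_of_mem_erase hD)
    · exact Finset.notMem_erase D _ hD
  · intro v D hv u hu
    rcases hlab v D hv with h0 | ⟨h0, -, rfl⟩
    · obtain ⟨E, hE, hl⟩ := h.label_down v D h0 u hu
      exact ⟨E, hE, hold u E hl⟩
    · exact hnew u hu
  · intro D hD hDa hr v hv
    by_cases hDC : D = C
    · subst hDC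
      obtain ⟨E, -, hE⟩ := hnew v hv
      simp [hE]
    · have h0 : D ∉ s.active := fun h1 => hDa (Finset.mem_erase.2 ⟨hDC, h1⟩)
      obtain ⟨E, hE⟩ := Option.ne_none_iff_exists'.1 (h.label_inactive D hD h0 hr v hv)
      simp [hold v E hE]

end DualInvariant

end Invariant

/-! ### Merging, preservation of the invariant, and termination of the growth phase. -/

section Steps

variable {V : Type*} [Fintype V] [DecidableEq V]

namespace GWState

theorem mem_comps_merge {r : V} {s : GWState V} {e : Sym2 V} {P Q C : Finset V} :
    C ∈ (s.merge r e P Q).comps ↔ C = P ∪ Q ∨ (C ∈ s.comps ∧ C ≠ P ∧ C ≠ Q) := by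
  simp only [merge, Finset.mem_insert, Finset.mem_erase]
  tauto

theorem mem_active_merge {r : V} {s : GWState V} {e : Sym2 V} {P Q C : Finset V} :
    C ∈ (s.merge r e P Q).active ↔
      (C = P ∪ Q ∧ r ∉ P ∪ Q) ∨ (C ∈ s.active ∧ C ≠ P ∧ C ≠ Q) := by
  simp only [merge]
  split_ifs with h <;> simp only [Finset.mem_insert, Finset.mem_erase] <;> tauto

end GWState

namespace DualInvariant

variable {G : SimpleGraph V} {r : V} {c : Sym2 V → ℝ} {π : V → ℝ} {s : GWState V}
  {y : Finset V → ℝ}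

theorem merge (h : DualInvariant G r c π s y) {i j : V} {P Q : Finset V}
    (hJ : s.Joins G i j P Q) (ht : c s(i, j) = s.d i + s.d j) :
    DualInvariant G r c π (s.merge r s(i, j) P Q) y := by
  obtain ⟨hadj, hP, hQ, hi, hj, hPQ, -⟩ := hJ
  -- Since the union is not yet a component, overwriting `w` there leaves the values of the other
  -- components intact.
  have hU : P ∪ Q ∉ s.comps := by
    intro h0
    have h1 := h.eq_of_mem _ h0 P hP i (Finset.mem_union_left _ hi) hi
    have h2 := h.eq_of_mem _ h0 Q hQ j (Finset.mem_union_right _ hj) hj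
    exact hPQ (h1.symm.trans h2)
  have hmono : ∀ C ∈ s.comps, ∃ D ∈ (s.merge r s(i, j) P Q).comps, C ⊆ D := by
    intro C hC
    by_cases h1 : C = P
    · exact ⟨P ∪ Q, GWState.mem_comps_merge.2 (Or.inl rfl), h1 ▸ Finset.subset_union_left⟩
    by_cases h2 : C = Q
    · exact ⟨P ∪ Q, GWState.mem_comps_merge.2 (Or.inl rfl), h2 ▸ Finset.subset_union_right⟩
    exact ⟨C, GWState.mem_comps_merge.2 (Or.inr ⟨hC, h1, h2⟩), le_rfl⟩
  have hdisj : ∀ C ∈ s.comps, ∀ v, v ∈ C → v ∈ P ∪ Q → C = P ∨ C = Q := by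
    intro C hC v hv hvU
    rcases Finset.mem_union.1 hvU with h0 | h0
    · exact Or.inl (h.eq_of_mem C hC P hP v hv h0)
    · exact Or.inr (h.eq_of_mem C hC Q hQ v hv h0)
  have hle : SimpleGraph.fromEdgeSet (s.F : Set (Sym2 V)) ≤
      SimpleGraph.fromEdgeSet ((s.merge r s(i, j) P Q).F : Set (Sym2 V)) := by
    refine SimpleGraph.fromEdgeSet_mono ?_
    simp [GWState.merge]
  have hcross : c s(i, j) = mass y {S | Crosses S s(i, j)} := by
    rw [h.crosses_eq hP hQ hi hj hPQ h.y_sub, ht, h.d_eq, h.d_eq]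
  refine
    { nonempty := ?_
      eq_of_mem := ?_
      cover := ?_
      active_sub := ?_
      root_notMem := ?_
      y_nonneg := h.y_nonneg
      y_nonempty := h.y_nonempty
      y_root := h.y_root
      y_sub := ?_
      w_eq := ?_
      d_eq := h.d_eq
      packing := h.packing
      edge_le := h.edge_le
      F_edge := ?_
      F_inside := ?_
      F_tight := ?_
      reach := ?_
      label_mem := h.label_mem
      label_tight := h.label_tight
      label_sub := ?_
      label_notMem := ?_
      label_down := h.label_down
      label_inactive := ?_ }
  · intro C hC
    rcases GWState.mem_comps_merge.1 hC with rfl | ⟨h0, -, -⟩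
    · exact ⟨i, Finset.mem_union_left _ hi⟩
    · exact h.nonempty C h0
  · intro C hC D hD v hvC hvD
    rcases GWState.mem_comps_merge.1 hC with rfl | ⟨hC, hC1, hC2⟩ <;>
      rcases GWState.mem_comps_merge.1 hD with rfl | ⟨hD, hD1, hD2⟩
    · rfl
    · rcases hdisj D hD v hvD hvC with h0 | h0 <;> contradiction
    · rcases hdisj C hC v hvC hvD with h0 | h0 <;> contradiction
    · exact h.eq_of_mem C hC D hD v hvC hvD
  · intro v
    obtain ⟨C, hC, hv⟩ := h.cover v
    obtain ⟨D, hD, hCD⟩ := hmono C hC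
    exact ⟨D, hD, hCD hv⟩
  · intro C hC
    rcases GWState.mem_active_merge.1 hC with ⟨h0, -⟩ | ⟨h0, h1⟩
    · exact GWState.mem_comps_merge.2 (Or.inl h0)
    · exact GWState.mem_comps_merge.2 (Or.inr ⟨h.active_sub h0, h1⟩)
  · intro C hC
    rcases GWState.mem_active_merge.1 hC with ⟨rfl, h0⟩ | ⟨h0, -⟩
    · exact h0
    · exact h.root_notMem C h0
  · intro S hS
    obtain ⟨C, hC, hSC⟩ := h.y_sub S hS
    obtain ⟨D, hD, hCD⟩ := hmono C hC
    exact ⟨D, hD, hSC.trans hCD⟩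
  · intro C hC
    rcases GWState.mem_comps_merge.1 hC with rfl | ⟨hC, -, -⟩
    · simp only [GWState.merge, Function.update_self]
      rw [h.w_eq P hP, h.w_eq Q hQ]
      classical
      simp only [mass, ← Finset.sum_add_distrib]
      refine Finset.sum_congr rfl fun S _ => ?_
      by_cases hS : y S = 0
      · simp [Set.indicator_apply, hS]
      obtain ⟨D, hD, hSD⟩ := h.y_sub S hS
      obtain ⟨v, hv⟩ := h.y_nonempty S hS
      have hu1 : S ⊆ P → S ⊆ P ∪ Q := fun h0 => h0.trans Finset.subset_union_left
      have hu2 : S ⊆ Q → S ⊆ P ∪ Q := fun h0 => h0.trans Finset.subset_union_right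
      have hu3 : S ⊆ P ∪ Q → S ⊆ P ∨ S ⊆ Q := by
        intro h0
        rcases hdisj D hD v (hSD hv) (h0 hv) with rfl | rfl
        · exact Or.inl hSD
        · exact Or.inr hSD
      have hu4 : ¬ (S ⊆ P ∧ S ⊆ Q) := fun h0 =>
        hPQ (h.eq_of_mem P hP Q hQ v (h0.1 hv) (h0.2 hv))
      simp only [Set.indicator_apply, Set.mem_ofPred_eq]
      split_ifs <;> first | (exfalso; tauto) | simp
    · have : C ≠ P ∪ Q := fun h0 => hU (h0 ▸ hC)
      simp only [GWState.merge, Function.update_of_ne this]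
      exact h.w_eq C hC
  · intro e he
    rcases Finset.mem_insert.1 he with rfl | he
    · exact hadj
    · exact h.F_edge e he
  · intro e he C hC hx
    rcases Finset.mem_insert.1 he with rfl | he
    · have hiU : i ∈ P ∪ Q := Finset.mem_union_left _ hi
      have hjU : j ∈ P ∪ Q := Finset.mem_union_right _ hj
      rcases GWState.mem_comps_merge.1 hC with rfl | ⟨hC, hC1, hC2⟩ <;>
        rcases crosses_mk.1 hx with ⟨h0, h1⟩ | ⟨h0, h1⟩
      · exact h1 hjU
      · exact h1 hiU
      · exact hC1 (h.eq_of_mem C hC P hP i h0 hi)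
      · exact hC2 (h.eq_of_mem C hC Q hQ j h0 hj)
    · rcases GWState.mem_comps_merge.1 hC with rfl | ⟨hC, -, -⟩
      · obtain ⟨a, b, rfl, ha, hb⟩ := hx
        rcases Finset.mem_union.1 ha with h0 | h0
        · exact h.F_inside _ he P hP
            ⟨a, b, rfl, h0, fun h1 => hb (Finset.mem_union_left _ h1)⟩
        · exact h.F_inside _ he Q hQ
            ⟨a, b, rfl, h0, fun h1 => hb (Finset.mem_union_right _ h1)⟩
      · exact h.F_inside e he C hC hx
  · intro e he
    rcases Finset.mem_insert.1 he with rfl | he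
    · exact hcross
    · exact h.F_tight e he
  · intro C hC u hu v hv
    rcases GWState.mem_comps_merge.1 hC with rfl | ⟨hC, -, -⟩
    · have hij : (SimpleGraph.fromEdgeSet
          ((s.merge r s(i, j) P Q).F : Set (Sym2 V))).Reachable i j := by
        refine SimpleGraph.Adj.reachable ?_
        rw [SimpleGraph.fromEdgeSet_adj]
        exact ⟨by simp [GWState.merge], hadj.ne⟩
      have key : ∀ x ∈ P ∪ Q, (SimpleGraph.fromEdgeSet
          ((s.merge r s(i, j) P Q).F : Set (Sym2 V))).Reachable i x := by
        intro x hx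
        rcases Finset.mem_union.1 hx with h0 | h0
        · exact (h.reach P hP i hi x h0).mono hle
        · exact hij.trans ((h.reach Q hQ j hj x h0).mono hle)
      exact (key u hu).symm.trans (key v hv)
    · exact (h.reach C hC u hu v hv).mono hle
  · intro v C hv D hD hvD
    obtain ⟨E, hE, hvE⟩ := h.cover v
    have hCE := h.label_sub v C hv E hE hvE
    rcases GWState.mem_comps_merge.1 hD with rfl | ⟨hD, -, -⟩
    · rcases hdisj E hE v hvE hvD with rfl | rfl
      · exact hCE.trans Finset.subset_union_left
      · exact hCE.trans Finset.subset_union_right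
    · exact h.label_sub v C hv D hD hvD
  · intro v C hv hC
    rcases GWState.mem_active_merge.1 hC with ⟨rfl, -⟩ | ⟨h0, -⟩
    -- The new component cannot already be a label: a label lies in one old component, but `P ∪ Q`
    -- meets two.
    · obtain ⟨E, hE, hvE⟩ := h.cover v
      have hCE := h.label_sub v _ hv E hE hvE
      have h1 := h.eq_of_mem E hE P hP i (hCE (Finset.mem_union_left _ hi)) hi
      have h2 := h.eq_of_mem E hE Q hQ j (hCE (Finset.mem_union_right _ hj)) hj
      exact hPQ (h1.symm.trans h2)
    · exact h.label_notMem v C hv h0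
  · intro C hC hCa hr
    rcases GWState.mem_comps_merge.1 hC with rfl | ⟨hC, h1⟩
    · exact (hCa (GWState.mem_active_merge.2 (Or.inl ⟨rfl, hr⟩))).elim
    · exact h.label_inactive C hC
        (fun h0 => hCa (GWState.mem_active_merge.2 (Or.inr ⟨h0, h1⟩))) hr

theorem edgeTime_nonneg (h : DualInvariant G r c π s y) {i j : V} {P Q : Finset V}
    (hJ : s.Joins G i j P Q) : 0 ≤ s.edgeTime c i j P Q := by
  obtain ⟨hadj, hP, hQ, hi, hj, hPQ, -⟩ := hJ
  have h1 := h.edge_le s(i, j) hadj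
  rw [h.crosses_eq hP hQ hi hj hPQ h.y_sub, ← h.d_eq, ← h.d_eq] at h1
  exact div_nonneg (by linarith) (add_nonneg (rate_nonneg P) (rate_nonneg Q))

theorem compTime_nonneg (h : DualInvariant G r c π s y) {C : Finset V} (hC : C ∈ s.active) :
    0 ≤ s.compTime π C := by
  have := h.packing C
  rw [← h.w_eq C (h.active_sub hC)] at this
  exact sub_nonneg.2 this

/-- An iteration of the growth phase preserves the invariant. -/
theorem step (h : DualInvariant G r c π s y) {s' : GWState V} (hs : GWStep G r c π s s') :
    ∃ t : ℝ, 0 ≤ t ∧ DualInvariant G r c π s' (fun S => y S + t * s.rate S) := by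
  cases hs with
  | deactivate C hC hmin =>
    refine ⟨s.compTime π C, h.compTime_nonneg hC, ?_⟩
    refine (h.grow (h.compTime_nonneg hC) hmin).deactivate hC ?_
    simp [GWState.grow, GWState.rate, hC, GWState.compTime]
  | merge i j P Q hJ hmin =>
    have ht := h.edgeTime_nonneg hJ
    have hg := h.grow ht hmin
    refine ⟨s.edgeTime c i j P Q, ht, hg.merge (P := P) (Q := Q) hJ ?_⟩
    obtain ⟨hadj, hP, hQ, hi, hj, hPQ, hact⟩ := hJ
    rw [hg.d_eq, hg.d_eq, mass_add_mul, mass_add_mul, h.rate_mass hP hi, h.rate_mass hQ hj,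
      ← h.d_eq, ← h.d_eq]
    have h2 : s.rate P + s.rate Q ≠ 0 := by
      have h1 := rate_nonneg (s := s) P
      have h3 := rate_nonneg (s := s) Q
      intro h0
      rcases hact with h4 | h4
      · have : s.rate P = 1 := if_pos h4
        linarith
      · have : s.rate Q = 1 := if_pos h4
        linarith
    have := div_mul_cancel₀ (c s(i, j) - s.d i - s.d j) h2
    rw [GWState.edgeTime]
    linarith

theorem exists_of_run (h : DualInvariant G r c π s y) {s' : GWState V}
    (hs : Relation.ReflTransGen (GWStep G r c π) s s') : ∃ z, DualInvariant G r c π s' z := by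
  induction hs with
  | refl => exact ⟨y, h⟩
  | tail _ hstep ih =>
    obtain ⟨z, hz⟩ := ih
    obtain ⟨t, -, ht⟩ := hz.step hstep
    exact ⟨_, ht⟩

end DualInvariant

/-- A merge loses one component, and it does not raise the number of active ones because `P` or `Q`
was active. A deactivation lowers the second summand, so the sum is a termination measure. -/
theorem GWState.card_merge_lt {G : SimpleGraph V} {r : V} {s : GWState V} {i j : V}
    {P Q : Finset V} (hJ : s.Joins G i j P Q) (e : Sym2 V) :
    (s.merge r e P Q).comps.card + (s.merge r e P Q).active.card <
      s.comps.card + s.active.card := by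
  obtain ⟨-, hP, hQ, -, -, hPQ, hact⟩ := hJ
  have h1 : (s.merge r e P Q).comps.card < s.comps.card := by
    have h2 := Finset.card_insert_le (P ∪ Q) ((s.comps.erase P).erase Q)
    have h3 := Finset.card_erase_add_one (Finset.mem_erase.2 ⟨hPQ.symm, hQ⟩)
    have h4 := Finset.card_erase_add_one hP
    simp only [GWState.merge]
    omega
  have h2 : (s.merge r e P Q).active.card ≤ s.active.card := by
    have h3 : ((s.active.erase P).erase Q).card + 1 ≤ s.active.card := by
      rcases hact with h0 | h0
      · have := Finset.card_erase_add_one h0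
        have := Finset.card_erase_le (s := s.active.erase P) (a := Q)
        omega
      · have := Finset.card_erase_add_one h0
        have := Finset.card_erase_le (s := s.active.erase Q) (a := P)
        rw [Finset.erase_right_comm]
        omega
    have h4 := Finset.card_insert_le (P ∪ Q) ((s.active.erase P).erase Q)
    simp only [GWState.merge]
    split_ifs <;> omega
  omega

theorem GWStep.card_lt {G : SimpleGraph V} {r : V} {c : Sym2 V → ℝ} {π : V → ℝ}
    {s s' : GWState V} (h : GWStep G r c π s s') :
    s'.comps.card + s'.active.card < s.comps.card + s.active.card := by
  cases h with
  | deactivate C hC _ =>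
    have := Finset.card_erase_add_one hC
    simp only [GWState.deactivate, GWState.grow]
    omega
  | merge i j P Q hJ _ =>
    exact GWState.card_merge_lt (s := s.grow _) hJ _

/-- There are finitely many events, and an active component always supplies one, so an earliest
event exists. -/
theorem GWStep.exists_of_active (G : SimpleGraph V) (r : V) (c : Sym2 V → ℝ) (π : V → ℝ)
    {s : GWState V} (h : s.active ≠ ∅) : ∃ s', GWStep G r c π s s' := by
  obtain ⟨C₀, hC₀⟩ := Finset.nonempty_iff_ne_empty.2 h
  obtain ⟨C, hC, hCmin⟩ := s.active.exists_min_image (s.compTime π) ⟨C₀, hC₀⟩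
  by_cases hE : ∃ x : V × V × Finset V × Finset V, s.Joins G x.1 x.2.1 x.2.2.1 x.2.2.2
  · obtain ⟨x, hx, hxmin⟩ := Set.exists_min_image
      {x : V × V × Finset V × Finset V | s.Joins G x.1 x.2.1 x.2.2.1 x.2.2.2}
      (fun x => s.edgeTime c x.1 x.2.1 x.2.2.1 x.2.2.2) (Set.toFinite _) hE
    rcases le_total (s.compTime π C) (s.edgeTime c x.1 x.2.1 x.2.2.1 x.2.2.2) with h0 | h0
    · exact ⟨_, GWStep.deactivate s C hC
        ⟨fun i j P Q hJ => h0.trans (hxmin (i, j, P, Q) hJ), hCmin⟩⟩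
    · exact ⟨_, GWStep.merge s _ _ _ _ hx
        ⟨fun i j P Q hJ => hxmin (i, j, P, Q) hJ, fun D hD => h0.trans (hCmin D hD)⟩⟩
  · exact ⟨_, GWStep.deactivate s C hC
      ⟨fun i j P Q hJ => (hE ⟨(i, j, P, Q), hJ⟩).elim, hCmin⟩⟩

/-- There is no infinite run of a program that decreases a natural number in each step. -/
theorem alwaysTerminates_of_measure {σ : Type*} {step : σ → σ → Prop} {done : σ → Prop}
    (f : σ → ℕ) (hf : ∀ s s', step s s' → f s' < f s)
    (hd : ∀ s, ¬ done s → ∃ s', step s s') (s₀ : σ) : AlwaysTerminates step done s₀ := by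
  refine ⟨fun s _ => or_iff_not_imp_left.2 (hd s), ?_⟩
  rintro ⟨run, -, hrun⟩
  have h : ∀ k, f (run k) + k ≤ f (run 0) := by
    intro k
    induction k with
    | zero => simp
    | succ k ih =>
      have := hf _ _ (hrun k)
      omega
  have := h (f (run 0) + 1)
  omega

theorem alwaysTerminates_gw (G : SimpleGraph V) (r : V) (c : Sym2 V → ℝ) (π : V → ℝ)
    (s : GWState V) : AlwaysTerminates (GWStep G r c π) (fun q => q.active = ∅) s :=
  alwaysTerminates_of_measure (fun q => q.comps.card + q.active.card)
    (fun _ _ h => h.card_lt) (fun _ h => GWStep.exists_of_active G r c π h) s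

theorem exists_run_to_inactive (G : SimpleGraph V) (r : V) (c : Sym2 V → ℝ) (π : V → ℝ)
    (s : GWState V) :
    ∃ s', Relation.ReflTransGen (GWStep G r c π) s s' ∧ s'.active = ∅ := by
  induction h : s.comps.card + s.active.card using Nat.strong_induction_on generalizing s with
  | _ m ih =>
    by_cases ha : s.active = ∅
    · exact ⟨s, .refl, ha⟩
    · obtain ⟨s₁, h₁⟩ := GWStep.exists_of_active G r c π ha
      obtain ⟨s', hs', ha'⟩ := ih _ (h ▸ h₁.card_lt) s₁ rfl
      exact ⟨s', .head h₁ hs', ha'⟩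

end Steps

/-! ### Degrees of components in the kept edges. -/

section Pruning

variable {V : Type*} [Fintype V] [DecidableEq V]

theorem exists_crosses_of_reachable {F : Finset (Sym2 V)} {S : Finset V} {u v : V}
    (h : (SimpleGraph.fromEdgeSet (F : Set (Sym2 V))).Reachable u v) (hu : u ∈ S) (hv : v ∉ S) :
    ∃ e ∈ F, Crosses S e := by
  obtain ⟨p⟩ := h
  obtain ⟨d, -, h1, h2⟩ := p.exists_boundary_dart (S : Set V) hu hv
  have hd := d.adj
  rw [SimpleGraph.fromEdgeSet_adj] at hd
  exact ⟨s(d.fst, d.snd), hd.1, d.fst, d.snd, rfl, h1, h2⟩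

open Classical in
/-- The number of edges of `F` with exactly one endpoint in `S`. -/
noncomputable def cutCard (F : Finset (Sym2 V)) (S : Finset V) : ℕ :=
  (F.filter fun e => Crosses S e).card

open Classical in
/-- The edges of `F` between distinct components. -/
noncomputable def crossing (s : GWState V) (F : Finset (Sym2 V)) : Finset (Sym2 V) :=
  F.filter fun e => ∃ C ∈ s.comps, Crosses C e

open Classical in
/-- The sets of the family `A` that contain a vertex of `T`. -/
noncomputable def meeting (A : Finset (Finset V)) (T : Finset V) : Finset (Finset V) :=
  A.filter fun C => ∃ v ∈ C, v ∈ T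

theorem mem_crossing {s : GWState V} {F : Finset (Sym2 V)} {e : Sym2 V} :
    e ∈ crossing s F ↔ e ∈ F ∧ ∃ C ∈ s.comps, Crosses C e := by
  classical
  simp [crossing]

theorem mem_meeting {A : Finset (Finset V)} {T C : Finset V} :
    C ∈ meeting A T ↔ C ∈ A ∧ ∃ v ∈ C, v ∈ T := by
  classical
  simp [meeting]

/-- What an earlier state `s` of a run knows about a later state `q`. -/
structure GWState.Extends (s q : GWState V) : Prop where
  label : ∀ v C, s.label v = some C → q.label v = some C
  edge : ∀ e ∈ q.F, e ∈ s.F ∨ ∃ C ∈ s.comps, Crosses C e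

variable {G : SimpleGraph V} {r : V} {c : Sym2 V → ℝ} {π : V → ℝ} {s q : GWState V}
  {y : Finset V → ℝ} {F : Finset (Sym2 V)} {T : Finset V}

theorem GWState.Extends.of_step (h : DualInvariant G r c π s y) {s' : GWState V}
    (hs : GWStep G r c π s s') (hq : s'.Extends q) : s.Extends q := by
  cases hs with
  | deactivate C hC hmin =>
    refine ⟨fun v D hv => hq.label v D ?_, hq.edge⟩
    simp [GWState.deactivate, GWState.grow, hv]
  | merge i j P Q hJ hmin =>
    obtain ⟨hadj, hP, hQ, hi, hj, hPQ, -⟩ := hJ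
    refine ⟨hq.label, fun e he => ?_⟩
    rcases hq.edge e he with h0 | ⟨C, hC, hCe⟩
    · rcases Finset.mem_insert.1 h0 with rfl | h0
      · exact Or.inr ⟨P, hP, i, j, rfl, hi, fun h1 => hPQ (h.eq_of_mem P hP Q hQ j h1 hj)⟩
      · exact Or.inl h0
    · rcases GWState.mem_comps_merge.1 hC with rfl | ⟨hC, -⟩
      · obtain ⟨a, b, rfl, ha, hb⟩ := hCe
        rw [Finset.mem_union, not_or] at hb
        rcases Finset.mem_union.1 ha with h0 | h0
        · exact Or.inr ⟨P, hP, a, b, rfl, h0, hb.1⟩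
        · exact Or.inr ⟨Q, hQ, a, b, rfl, h0, hb.2⟩
      · exact Or.inr ⟨C, hC, hCe⟩

/-- Undoing a merge makes at most the edge `s(i, j)` crossing. If that edge is kept, both its ends
lie in `T`, so `P` and `Q` both meet `T` and the count of meeting components rises by one as well.
-/
theorem card_crossing_of_step (h : DualInvariant G r c π s y) {s' : GWState V}
    (hs : GWStep G r c π s s') (hq : s'.Extends q) (hF : F ⊆ q.F)
    (hT : ∀ e ∈ F, ∀ v ∈ e, v ∈ T)
    (hcard : (crossing s' F).card + 1 ≤ (meeting s'.comps T).card) :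
    (crossing s F).card + 1 ≤ (meeting s.comps T).card := by
  cases hs with
  | deactivate C hC hmin => exact hcard
  | merge i j P Q hJ hmin =>
    obtain ⟨hadj, hP, hQ, hi, hj, hPQ, -⟩ := hJ
    set t := s.edgeTime c i j P Q
    set s' := (s.grow t).merge r s(i, j) P Q
    have hcomps : ∀ C, C ∈ s'.comps ↔ C = P ∪ Q ∨ (C ∈ s.comps ∧ C ≠ P ∧ C ≠ Q) := fun C =>
      GWState.mem_comps_merge
    have hcr : crossing s F ⊆ insert s(i, j) (crossing s' F) := by
      intro e he
      obtain ⟨heF, C, hC, hCe⟩ := mem_crossing.1 he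
      rcases hq.edge e (hF heF) with h0 | h0
      · rcases Finset.mem_insert.1 h0 with rfl | h0
        · exact Finset.mem_insert_self _ _
        · exact (h.F_inside e h0 C hC hCe).elim
      · exact Finset.mem_insert_of_mem (mem_crossing.2 ⟨heF, h0⟩)
    have hmem : ∀ C, C ∈ meeting s'.comps T → C = P ∪ Q ∨
        (C ∈ meeting s.comps T ∧ C ≠ P ∧ C ≠ Q) := by
      intro C hC
      rw [mem_meeting, hcomps] at hC
      rcases hC with ⟨rfl | ⟨h1, h2⟩, h3⟩
      · exact Or.inl rfl
      · exact Or.inr ⟨mem_meeting.2 ⟨h1, h3⟩, h2⟩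
    by_cases hPT : P ∈ meeting s.comps T
    · by_cases hQT : Q ∈ meeting s.comps T
      · have h1 : meeting s'.comps T ⊆
            insert (P ∪ Q) (((meeting s.comps T).erase P).erase Q) := by
          intro C hC
          rcases hmem C hC with h0 | ⟨h0, h1, h2⟩
          · exact h0 ▸ Finset.mem_insert_self _ _
          · exact Finset.mem_insert_of_mem
              (Finset.mem_erase.2 ⟨h2, Finset.mem_erase.2 ⟨h1, h0⟩⟩)
        have h2 := (Finset.card_le_card h1).trans (Finset.card_insert_le _ _)
        have h3 := Finset.card_erase_add_one (Finset.mem_erase.2 ⟨hPQ.symm, hQT⟩)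
        have h4 := Finset.card_erase_add_one hPT
        have h5 := (Finset.card_le_card hcr).trans (Finset.card_insert_le _ _)
        omega
      · have h1 : meeting s'.comps T ⊆ insert (P ∪ Q) ((meeting s.comps T).erase P) := by
          intro C hC
          rcases hmem C hC with h0 | ⟨h0, h1, h2⟩
          · exact h0 ▸ Finset.mem_insert_self _ _
          · exact Finset.mem_insert_of_mem (Finset.mem_erase.2 ⟨h1, h0⟩)
        have h2 := (Finset.card_le_card h1).trans (Finset.card_insert_le _ _)
        have h4 := Finset.card_erase_add_one hPT
        have h5 : crossing s F ⊆ crossing s' F := by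
          intro e he
          rcases Finset.mem_insert.1 (hcr he) with rfl | h0
          · exact (hQT (mem_meeting.2 ⟨hQ, j, hj,
              hT _ (mem_crossing.1 he).1 j (Sym2.mem_mk_right i j)⟩)).elim
          · exact h0
        have h6 := Finset.card_le_card h5
        omega
    · have h5 : crossing s F ⊆ crossing s' F := by
        intro e he
        rcases Finset.mem_insert.1 (hcr he) with rfl | h0
        · exact (hPT (mem_meeting.2 ⟨hP, i, hi,
            hT _ (mem_crossing.1 he).1 i (Sym2.mem_mk_left i j)⟩)).elim
        · exact h0
      have h6 := Finset.card_le_card h5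
      have h7 : (meeting s'.comps T).card ≤ (meeting s.comps T).card := by
        by_cases hQT : Q ∈ meeting s.comps T
        · have h1 : meeting s'.comps T ⊆ insert (P ∪ Q) ((meeting s.comps T).erase Q) := by
            intro C hC
            rcases hmem C hC with h0 | ⟨h0, h1, h2⟩
            · exact h0 ▸ Finset.mem_insert_self _ _
            · exact Finset.mem_insert_of_mem (Finset.mem_erase.2 ⟨h2, h0⟩)
          have h2 := (Finset.card_le_card h1).trans (Finset.card_insert_le _ _)
          have h4 := Finset.card_erase_add_one hQT
          omega
        · refine Finset.card_le_card fun C hC => ?_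
          rcases hmem C hC with rfl | h0
          · obtain ⟨-, v, hv, hvT⟩ := mem_meeting.1 hC
            rcases Finset.mem_union.1 hv with h0 | h0
            · exact (hPT (mem_meeting.2 ⟨hP, v, h0, hvT⟩)).elim
            · exact (hQT (mem_meeting.2 ⟨hQ, v, h0, hvT⟩)).elim
          · exact h0.1
      omega

theorem extends_of_run (h : DualInvariant G r c π s y)
    (hs : Relation.ReflTransGen (GWStep G r c π) s q) : s.Extends q := by
  induction hs using Relation.ReflTransGen.head_induction_on generalizing y with
  | refl => exact ⟨fun _ _ h => h, fun _ h => Or.inl h⟩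
  | head hstep _ ih =>
    obtain ⟨t, -, ht⟩ := h.step hstep
    exact GWState.Extends.of_step h hstep (ih ht)

/-- The kept edges between distinct components form a forest on the components that meet `T`. -/
theorem card_crossing_add_one_le (h : DualInvariant G r c π s y)
    (hs : Relation.ReflTransGen (GWStep G r c π) s q) (hF : F ⊆ q.F)
    (hT : ∀ e ∈ F, ∀ v ∈ e, v ∈ T) (hr : r ∈ T) :
    (crossing s F).card + 1 ≤ (meeting s.comps T).card := by
  induction hs using Relation.ReflTransGen.head_induction_on generalizing y with
  | refl =>
    have h1 : crossing q F = ∅ := by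
      refine Finset.eq_empty_of_forall_notMem fun e he => ?_
      obtain ⟨heF, C, hC, hCe⟩ := mem_crossing.1 he
      exact h.F_inside e (hF heF) C hC hCe
    obtain ⟨C, hC, hrC⟩ := h.cover r
    have h2 : 0 < (meeting q.comps T).card :=
      Finset.card_pos.2 ⟨C, mem_meeting.2 ⟨hC, r, hrC, hr⟩⟩
    rw [h1, Finset.card_empty]
    omega
  | head hstep hrun ih =>
    obtain ⟨t, -, ht⟩ := h.step hstep
    exact card_crossing_of_step h hstep (extends_of_run ht hrun) hF hT (ih ht)

/-- Deleting the only kept edge that leaves an inactive component keeps the requirements. -/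
theorem two_le_cutCard (h : DualInvariant G r c π s y) (hq : s.Extends q)
    (hl : ∀ v C, q.label v = some C → v ∈ C) (hF : PruneFeasible r q F)
    (hmin : ∀ F', PruneFeasible r q F' → F.card ≤ F'.card)
    {C : Finset V} (hC : C ∈ s.comps) (hCa : C ∉ s.active) (hr : r ∉ C) {v : V} (hv : v ∈ C)
    (hvr : ConnectedToRoot r F v) : 2 ≤ cutCard F C := by
  classical
  obtain ⟨e, heF, heC⟩ := exists_crosses_of_reachable hvr.symm hv hr
  by_contra hlt
  have hone : ∀ e' ∈ F, Crosses C e' → e' = e := by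
    intro e' he' hce'
    have h1 : (F.filter fun e => Crosses C e).card ≤ 1 := by
      unfold cutCard at hlt
      convert Nat.lt_succ_iff.1 (not_le.1 hlt)
    exact Finset.card_le_one.1 h1 e' (Finset.mem_filter.2 ⟨he', hce'⟩) e
      (Finset.mem_filter.2 ⟨heF, heC⟩)
  obtain ⟨b, a, rfl, hb, ha⟩ := heC
  have hmono : ∀ u, ConnectedToRoot r (F.erase s(b, a)) u → ConnectedToRoot r F u := fun u hu =>
    hu.mono (SimpleGraph.fromEdgeSet_mono (by simp))
  have hnot : ∀ u ∈ C, ¬ ConnectedToRoot r (F.erase s(b, a)) u := by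
    intro u hu hur
    obtain ⟨e', he', hce'⟩ := exists_crosses_of_reachable hur.symm hu hr
    exact Finset.ne_of_mem_erase he' (hone e' (Finset.mem_of_mem_erase he') hce')
  -- A walk from the root can enter and leave `C` only through the edge between `b` and `a`. While
  -- it is inside `C`, the induction remembers that the outer end `a` is still reachable, for use
  -- when it leaves.
  have hkeep : ∀ u, ConnectedToRoot r F u →
      (u ∉ C → ConnectedToRoot r (F.erase s(b, a)) u) ∧
      (u ∈ C → ConnectedToRoot r (F.erase s(b, a)) a) := by
    intro u hu
    rw [ConnectedToRoot, SimpleGraph.reachable_iff_reflTransGen] at hu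
    induction hu with
    | refl => exact ⟨fun _ => SimpleGraph.Reachable.refl _, fun h0 => (hr h0).elim⟩
    | @tail x z _ hxz ih =>
      rw [SimpleGraph.fromEdgeSet_adj] at hxz
      by_cases hx : x ∈ C <;> by_cases hz : z ∈ C
      · exact ⟨fun h0 => (h0 hz).elim, fun _ => ih.2 hx⟩
      · have := hone _ hxz.1 ⟨x, z, rfl, hx, hz⟩
        rcases Sym2.eq_iff.1 this with ⟨-, rfl⟩ | ⟨rfl, -⟩
        · exact ⟨fun _ => ih.2 hx, fun h0 => (hz h0).elim⟩
        · exact (ha hx).elim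
      · have := hone _ hxz.1 ⟨z, x, Sym2.eq_swap, hz, hx⟩
        rcases Sym2.eq_iff.1 this with ⟨rfl, -⟩ | ⟨rfl, -⟩
        · exact (hx hb).elim
        · exact ⟨fun h0 => (h0 hz).elim, fun _ => ih.1 hx⟩
      · refine ⟨fun _ => (ih.1 hx).trans (SimpleGraph.Adj.reachable ?_), fun h0 => (hz h0).elim⟩
        rw [SimpleGraph.fromEdgeSet_adj]
        refine ⟨Finset.mem_erase.2 ⟨fun h0 => ?_, hxz.1⟩, hxz.2⟩
        rcases Sym2.eq_iff.1 h0 with ⟨rfl, -⟩ | ⟨-, rfl⟩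
        · exact hx hb
        · exact hz hb
  have hlab : ∀ u ∈ C, ∃ D ⊆ C, q.label u = some D := by
    intro u hu
    obtain ⟨D, hD⟩ := Option.ne_none_iff_exists'.1 (h.label_inactive C hC hCa hr u hu)
    exact ⟨D, h.label_sub u D hD C hC hu, hq.label u D hD⟩
  have hfeas : PruneFeasible r q (F.erase s(b, a)) := by
    refine ⟨(Finset.erase_subset _ _).trans hF.1, fun u hu => ?_, fun u x D E hu hx hDE hur => ?_⟩
    · refine (hkeep u (hF.2.1 u hu)).1 fun h0 => ?_
      obtain ⟨D, -, hD⟩ := hlab u h0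
      rw [hu] at hD
      cases hD
    -- If `x` were in `C`, its label would lie in `C`, and so would `u ∈ D ⊆ E`; but no vertex of
    -- `C` remains connected to the root.
    · refine (hkeep x (hF.2.2 u x D E hu hx hDE (hmono u hur))).1 fun hxC => ?_
      obtain ⟨E', hE', hxE'⟩ := hlab x hxC
      rw [hx] at hxE'
      cases hxE'
      exact hnot u (hE' (hDE (hl u D hu))) hur
  have := hmin _ hfeas
  have h2 := Finset.card_erase_add_one heF
  omega

/-- Handshake: an edge crosses at most the two components containing its ends. -/
theorem sum_cutCard_le (h : DualInvariant G r c π s y) (F : Finset (Sym2 V)) :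
    ∑ C ∈ s.comps, cutCard F C ≤ 2 * (crossing s F).card := by
  classical
  have h1 : ∑ C ∈ s.comps, cutCard F C =
      ∑ e ∈ F, (s.comps.filter fun C => Crosses C e).card := by
    simp only [cutCard, Finset.card_filter]
    rw [Finset.sum_comm]
  have h2 : (crossing s F).card = ∑ e ∈ F, if ∃ C ∈ s.comps, Crosses C e then 1 else 0 := by
    rw [← Finset.card_filter]
    rfl
  rw [h1, h2, Finset.mul_sum]
  refine Finset.sum_le_sum fun e _ => ?_
  split_ifs with h0
  · induction e using Sym2.ind with
    | _ i j =>
    obtain ⟨P, hP, hi⟩ := h.cover i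
    obtain ⟨Q, hQ, hj⟩ := h.cover j
    refine (Finset.card_le_card (t := {P, Q}) fun C hC => ?_).trans Finset.card_le_two
    obtain ⟨hC, hx⟩ := Finset.mem_filter.1 hC
    rcases crosses_mk.1 hx with ⟨h3, -⟩ | ⟨h3, -⟩
    · simp [h.eq_of_mem C hC P hP i h3 hi]
    · simp [h.eq_of_mem C hC Q hQ j h3 hj]
  · simp only [mul_zero, nonpos_iff_eq_zero, Finset.card_eq_zero]
    exact Finset.filter_eq_empty_iff.2 fun C hC hx => h0 ⟨C, hC, hx⟩

/-- The active components that meet `T` have average degree at most `2 - 1 / n`. -/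
theorem sum_active_cutCard_le [Nontrivial V] (h : DualInvariant G r c π s y) (hq : s.Extends q)
    (hl : ∀ v C, q.label v = some C → v ∈ C) (hF : PruneFeasible r q F)
    (hmin : ∀ F', PruneFeasible r q F' → F.card ≤ F'.card)
    (hT : ∀ e ∈ F, ∀ v ∈ e, v ∈ T) (hTr : ∀ v, v ∈ T ↔ ConnectedToRoot r F v)
    (hcard : (crossing s F).card + 1 ≤ (meeting s.comps T).card) :
    ∑ C ∈ s.active, (cutCard F C : ℝ) ≤ factor r * (meeting s.active T).card := by
  classical
  have hr : r ∈ T := (hTr r).2 (SimpleGraph.Reachable.refl _)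
  obtain ⟨R, hR, hrR⟩ := h.cover r
  have hRa : R ∉ s.active := fun h0 => h.root_notMem R h0 hrR
  set A := meeting s.active T
  have hAs : A ⊆ s.active := fun C hC => (mem_meeting.1 hC).1
  have hzero : ∑ C ∈ s.active, cutCard F C = ∑ C ∈ A, cutCard F C := by
    refine (Finset.sum_subset hAs fun C hC hCA => ?_).symm
    rw [cutCard, Finset.card_eq_zero, Finset.filter_eq_empty_iff]
    rintro e he ⟨i, j, rfl, hi, -⟩
    exact hCA (mem_meeting.2 ⟨hC, i, hi, hT _ he i (Sym2.mem_mk_left i j)⟩)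
  set B := (meeting s.comps T \ A).erase R
  have hRm : R ∈ meeting s.comps T \ A :=
    Finset.mem_sdiff.2 ⟨mem_meeting.2 ⟨hR, r, hrR, hr⟩, fun h0 => hRa (hAs h0)⟩
  have hAm : A ⊆ meeting s.comps T := fun C hC =>
    mem_meeting.2 ⟨h.active_sub (mem_meeting.1 hC).1, (mem_meeting.1 hC).2⟩
  have hB : 2 * B.card ≤ ∑ C ∈ B, cutCard F C := by
    rw [mul_comm, ← smul_eq_mul]
    refine Finset.card_nsmul_le_sum _ _ _ fun C hC => ?_
    obtain ⟨hCR, hC⟩ := Finset.mem_erase.1 hC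
    obtain ⟨hCm, hCA⟩ := Finset.mem_sdiff.1 hC
    obtain ⟨hCc, v, hv, hvT⟩ := mem_meeting.1 hCm
    exact two_le_cutCard h hq hl hF hmin hCc (fun h0 => hCA (mem_meeting.2 ⟨h0, v, hv, hvT⟩))
      (fun h0 => hCR (h.eq_of_mem C hCc R hR r h0 hrR)) hv ((hTr v).1 hvT)
  have hBcard : B.card + 1 = (meeting s.comps T \ A).card := Finset.card_erase_add_one hRm
  have hBsum : cutCard F R + ∑ C ∈ B, cutCard F C = ∑ C ∈ meeting s.comps T \ A, cutCard F C :=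
    Finset.add_sum_erase _ (cutCard F) hRm
  have hmcard := Finset.card_sdiff_add_card_eq_card hAm
  have hmsum := Finset.sum_sdiff (f := cutCard F) hAm
  have hle : ∑ C ∈ meeting s.comps T, cutCard F C ≤ ∑ C ∈ s.comps, cutCard F C :=
    Finset.sum_le_sum_of_subset fun C hC => (mem_meeting.1 hC).1
  have htot := sum_cutCard_le h F
  -- The total degree is at most `2 (|A| + |B| + 1) - 2`, and the inactive components in `B` use at
  -- least `2 |B|` of it.
  have hkey : ∑ C ∈ A, cutCard F C + cutCard F R ≤ 2 * A.card := by omega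
  -- Active components are disjoint, nonempty and avoid the root, so representatives inject them
  -- into the non-root vertices.
  have hn : A.card ≤ (Finset.univ.erase r).card := by
    have hch : ∀ C : Finset V, ∃ v, C ∈ A → v ∈ C := by
      intro C
      by_cases hC : C ∈ A
      · obtain ⟨v, hv⟩ := h.nonempty C (h.active_sub (hAs hC))
        exact ⟨v, fun _ => hv⟩
      · exact ⟨r, fun h0 => (hC h0).elim⟩
    choose f hf using hch
    refine Finset.card_le_card_of_injOn f (fun C hC => ?_) fun C hC D hD hCD => ?_
    · refine Finset.mem_coe.2 (Finset.mem_erase.2 ⟨fun h0 => ?_, Finset.mem_univ _⟩)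
      exact h.root_notMem C (hAs hC) (h0 ▸ hf C hC)
    · exact h.eq_of_mem C (h.active_sub (hAs hC)) D (h.active_sub (hAs hD)) (f C) (hf C hC)
        (hCD ▸ hf D hD)
  have hpos : 0 < (Finset.univ.erase r).card := by
    obtain ⟨v, hv⟩ := exists_ne r
    exact Finset.card_pos.2 ⟨v, Finset.mem_erase.2 ⟨hv, Finset.mem_univ v⟩⟩
  rw [← Nat.cast_sum, hzero, factor]
  by_cases hA : A.card = 0
  · rw [hA] at hkey ⊢
    have : ∑ C ∈ A, cutCard F C = 0 := by omega
    simp [this]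
  · obtain ⟨C, hC⟩ := Finset.card_pos.1 (Nat.pos_of_ne_zero hA)
    obtain ⟨hCa, v, hv, hvT⟩ := mem_meeting.1 hC
    obtain ⟨e, he, hx⟩ := exists_crosses_of_reachable ((hTr v).1 hvT) hrR
      fun h0 => hRa (h.eq_of_mem C (h.active_sub hCa) R hR v hv h0 ▸ hCa)
    -- The component of the root has degree at least 1. This saves 1 in the degree sum, and `1 ≥ |A|
    -- / n` turns the saving into the term `- 1 / n` of the factor.
    have h1 : 0 < cutCard F R := Finset.card_pos.2 ⟨e, Finset.mem_filter.2 ⟨he, hx⟩⟩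
    have h2 : ∑ C ∈ A, cutCard F C + 1 ≤ 2 * A.card := by omega
    have h3 : ((∑ C ∈ A, cutCard F C : ℕ) : ℝ) + 1 ≤ 2 * A.card := by exact_mod_cast h2
    have h4 : (A.card : ℝ) / (Finset.univ.erase r).card ≤ 1 :=
      (div_le_one (by exact_mod_cast hpos)).2 (by exact_mod_cast hn)
    have h5 : (2 - 1 / ((Finset.univ.erase r).card : ℝ)) * A.card =
        2 * A.card - A.card / (Finset.univ.erase r).card := by ring
    linarith

/-- The dual cost of the kept edges is paid for by the dual variables that meet `T`. -/
theorem exists_dual_of_run [Nontrivial V] (h : DualInvariant G r c π s y)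
    (hs : Relation.ReflTransGen (GWStep G r c π) s q)
    (hl : ∀ v C, q.label v = some C → v ∈ C) (hF : PruneFeasible r q F)
    (hmin : ∀ F', PruneFeasible r q F' → F.card ≤ F'.card)
    (hT : ∀ e ∈ F, ∀ v ∈ e, v ∈ T) (hTr : ∀ v, v ∈ T ↔ ConnectedToRoot r F v)
    (hy : ∑ S, y S * cutCard F S ≤ factor r * mass y {S | ∃ v ∈ S, v ∈ T}) :
    ∃ z, DualInvariant G r c π q z ∧
      ∑ S, z S * cutCard F S ≤ factor r * mass z {S | ∃ v ∈ S, v ∈ T} := by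
  classical
  induction hs using Relation.ReflTransGen.head_induction_on generalizing y with
  | refl => exact ⟨y, h, hy⟩
  | @head s s' hstep hrun ih =>
    obtain ⟨t, ht0, ht⟩ := h.step hstep
    -- Both sides are linear in the dual, so it is enough to compare their growth rates at `s`; the
    -- kept edges `F` come from the end of the run.
    refine ih ht ?_
    have hrun' := Relation.ReflTransGen.head hstep hrun
    have hr : r ∈ T := (hTr r).2 (SimpleGraph.Reachable.refl _)
    have h1 := sum_active_cutCard_le h (extends_of_run h hrun') hl hF hmin hT hTr
      (card_crossing_add_one_le h hrun' hF.1 hT hr)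
    have h2 : ∑ S, s.rate S * cutCard F S = ∑ C ∈ s.active, (cutCard F C : ℝ) := by
      simp [GWState.rate, ite_mul, Finset.sum_ite_mem]
    have h3 : mass s.rate {S | ∃ v ∈ S, v ∈ T} = (meeting s.active T).card := by
      rw [meeting, Finset.card_filter, mass, Nat.cast_sum]
      simp only [Set.indicator_apply, Set.mem_ofPred_eq, GWState.rate]
      rw [← Finset.sum_subset (Finset.subset_univ s.active)]
      · refine Finset.sum_congr rfl fun C hC => ?_
        simp [hC]
      · intro C _ hC
        simp [hC]
    rw [mass_add_mul, h3]
    simp only [add_mul, mul_assoc, Finset.sum_add_distrib, ← Finset.mul_sum]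
    rw [h2]
    have := mul_le_mul_of_nonneg_left h1 ht0
    linarith

end Pruning

/-! ### Weak duality and the approximation guarantee. -/

section Guarantee

variable {V : Type*} [Fintype V] [DecidableEq V]
  {G : SimpleGraph V} {r : V} {c : Sym2 V → ℝ} {π : V → ℝ} {q : GWState V}
  {z : Finset V → ℝ} {F : Finset (Sym2 V)}

theorem factor_pos [Nontrivial V] (r : V) : 0 < factor r := by
  obtain ⟨v, hv⟩ := exists_ne r
  have hpos : 0 < (Finset.univ.erase r).card :=
    Finset.card_pos.2 ⟨v, Finset.mem_erase.2 ⟨hv, Finset.mem_univ v⟩⟩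
  have h1 : (1 : ℝ) ≤ (Finset.univ.erase r).card := by exact_mod_cast hpos
  have h2 : 1 / ((Finset.univ.erase r).card : ℝ) ≤ 1 := (div_le_one (by linarith)).2 h1
  rw [factor]
  linarith

theorem length_eq_sum {T : G.Subgraph} (hT : T.edgeSet = (F : Set (Sym2 V)))
    (len : Sym2 V → ℝ) : length len T = ∑ e ∈ F, len e := by
  rw [length, hT, finsum_mem_coe_finset]

theorem weight_eq_sum {T : G.Subgraph} {U : Finset V} (hT : T.verts = (U : Set V))
    (p : V → ℝ) : weight p T = ∑ v ∈ U, p v := by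
  rw [weight, hT, finsum_mem_coe_finset]

open Classical in
theorem exists_finset_verts (T : G.Subgraph) : ∃ U : Finset V, T.verts = (U : Set V) :=
  ⟨Finset.univ.filter (· ∈ T.verts), by ext; simp⟩

open Classical in
theorem exists_finset_edgeSet (T : G.Subgraph) :
    ∃ F : Finset (Sym2 V), T.edgeSet = (F : Set (Sym2 V)) :=
  ⟨Finset.univ.filter (· ∈ T.edgeSet), by ext; simp⟩

/-- Weak duality: a connected subgraph pays for the whole dual solution. -/
theorem mass_univ_le (h : DualInvariant G r c π q z) {T : G.Subgraph} (hr : r ∈ T.verts)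
    (hT : T.coe.Connected) :
    mass z Set.univ ≤ length c T + (∑ v, π v - weight π T) := by
  classical
  obtain ⟨U, hU⟩ := exists_finset_verts T
  obtain ⟨E, hE⟩ := exists_finset_edgeSet T
  rw [length_eq_sum hE, weight_eq_sum hU, ← Finset.sum_compl_add_sum U π, add_sub_cancel_right]
  have h1 : ∑ e ∈ E, mass z {S | Crosses S e} ≤ ∑ e ∈ E, c e :=
    Finset.sum_le_sum fun e he => h.edge_le e (T.edgeSet_subset (hE ▸ he))
  have h2 := h.packing Uᶜ
  have h3 : mass z Set.univ ≤ ∑ e ∈ E, mass z {S | Crosses S e} + mass z {S | S ⊆ Uᶜ} := by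
    simp only [mass]
    rw [Finset.sum_comm, ← Finset.sum_add_distrib]
    refine Finset.sum_le_sum fun S _ => ?_
    simp only [Set.indicator_univ]
    have hnn : ∀ e ∈ E, 0 ≤ Set.indicator {S | Crosses S e} z S := fun e _ =>
      Set.indicator_nonneg (fun S _ => h.y_nonneg S) S
    by_cases hS : z S = 0
    · rw [hS]
      exact add_nonneg (Finset.sum_nonneg hnn) (Set.indicator_nonneg (fun S _ => h.y_nonneg S) S)
    by_cases hSU : S ⊆ Uᶜ
    · rw [Set.indicator_of_mem (show S ∈ {S | S ⊆ Uᶜ} from hSU)]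
      linarith [Finset.sum_nonneg hnn]
    · obtain ⟨v, hv, hvU⟩ := Finset.not_subset.1 hSU
      have hvT : v ∈ T.verts := by
        rw [hU]
        simpa using hvU
      -- A dual set avoids the root, so if it meets `T`, a path in `T` to the root leaves it and one
      -- edge of `T` pays for it.
      obtain ⟨p⟩ := hT.preconnected ⟨v, hvT⟩ ⟨r, hr⟩
      obtain ⟨d, -, h4, h5⟩ := p.exists_boundary_dart {x | x.1 ∈ S} hv (h.y_root S hS)
      have hd : s(d.fst.1, d.snd.1) ∈ E := by
        rw [← Finset.mem_coe, ← hE]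
        exact d.adj
      have h6 := Finset.single_le_sum hnn hd
      rw [Set.indicator_of_mem (show S ∈ {S | Crosses S s(d.fst.1, d.snd.1)} from
        ⟨_, _, rfl, h4, h5⟩)] at h6
      have := Set.indicator_nonneg (s := {S | S ⊆ Uᶜ}) (fun S _ => h.y_nonneg S) S
      linarith
  linarith

/-- The vertices that are not connected to the root use up their penalties. -/
theorem mass_compl_eq (h : DualInvariant G r c π q z) (hF : PruneFeasible r q F)
    {T : Finset V} (hTr : ∀ v, v ∈ T ↔ ConnectedToRoot r F v) :
    mass z {S | S ⊆ Tᶜ} = ∑ v ∈ Tᶜ, π v := by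
  classical
  have hlab : ∀ v : V, ∃ C : Finset V, v ∈ Tᶜ → q.label v = some C := by
    intro v
    by_cases hv : v ∈ T
    · exact ⟨∅, fun h0 => (Finset.mem_compl.1 h0 hv).elim⟩
    · obtain ⟨C, hC⟩ := Option.ne_none_iff_exists'.1 fun h0 => hv ((hTr v).2 (hF.2.1 v h0))
      exact ⟨C, fun _ => hC⟩
  choose L hL using hlab
  -- A vertex `u` of `L v` has a label inside `L v`; were it connected to the root, the second
  -- pruning rule would connect `v` too.
  have hLsub : ∀ v ∈ Tᶜ, L v ⊆ Tᶜ := by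
    intro v hv u hu
    rw [Finset.mem_compl]
    intro huT
    obtain ⟨D, hD, hDl⟩ := h.label_down v _ (hL v hv) u hu
    exact Finset.mem_compl.1 hv
      ((hTr v).2 (hF.2.2 u v D (L v) hDl (hL v hv) hD ((hTr u).1 huT)))
  have hunion : Tᶜ.biUnion L = Tᶜ := by
    ext v
    rw [Finset.mem_biUnion]
    constructor
    · rintro ⟨u, hu, hv⟩
      exact hLsub u hu hv
    · exact fun hv => ⟨v, hv, h.label_mem v _ (hL v hv)⟩
  have key : ∀ A : Finset V, A ⊆ Tᶜ →
      mass z {S | S ⊆ A.biUnion L} = ∑ v ∈ A.biUnion L, π v := by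
    intro A
    induction A using Finset.induction_on with
    | empty =>
      intro _
      rw [Finset.biUnion_empty, Finset.sum_empty]
      refine mass_eq_zero fun S hS => ?_
      by_contra h0
      exact (h.y_nonempty S h0).ne_empty (Finset.subset_empty.1 hS)
    | insert v A _ ih =>
      intro hA
      rw [Finset.biUnion_insert]
      rw [Finset.insert_subset_iff] at hA
      exact tight_union h.y_nonneg h.packing (h.label_tight v _ (hL v hA.1)) (ih hA.2)
  rw [← hunion]
  exact key _ le_rfl

theorem mem_of_isGWOutput {T : G.Subgraph} {U : Finset V} (hU : T.verts = (U : Set V))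
    (hE : T.edgeSet = (F : Set (Sym2 V))) : ∀ e ∈ F, ∀ v ∈ e, v ∈ U := by
  intro e he v hv
  rw [← Finset.mem_coe, ← hU]
  exact T.mem_verts_of_mem_edge (hE ▸ he) hv

/-- The Lagrangian-preserving guarantee of the Goemans–Williamson algorithm. -/
theorem gw_guarantee [Nontrivial V] (hc : ∀ e ∈ G.edgeSet, 0 ≤ c e) (hπ : ∀ v, 0 ≤ π v)
    {T T' : G.Subgraph} (hT : IsGWOutput G r c π T) (hr : r ∈ T'.verts)
    (hT' : T'.coe.Connected) :
    length c T - factor r * weight π T ≤ factor r * (length c T' - weight π T') := by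
  classical
  obtain ⟨q, F, hrun, -, hF, hmin, hV, hE⟩ := hT
  obtain ⟨U, hU⟩ := exists_finset_verts T
  have hTr : ∀ v, v ∈ U ↔ ConnectedToRoot r F v := by
    intro v
    rw [← Finset.mem_coe, ← hU, hV]
    rfl
  have h0 := DualInvariant.init (r := r) hc hπ
  -- This dual serves only to show that final labels contain their vertices; the one that carries
  -- the cost estimate is `z`.
  obtain ⟨y, hy⟩ := h0.exists_of_run hrun
  obtain ⟨z, hz, hcost⟩ := exists_dual_of_run h0 hrun hy.label_mem hF hmin
    (mem_of_isGWOutput hU hE) hTr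
    (by rw [mass_eq_zero (y := fun _ => (0 : ℝ)) fun _ _ => rfl]; simp)
  have h1 : length c T = ∑ S, z S * cutCard F S := by
    rw [length_eq_sum hE, Finset.sum_congr rfl fun e he => hz.F_tight e (hF.1 he)]
    simp only [mass]
    rw [Finset.sum_comm]
    refine Finset.sum_congr rfl fun S _ => ?_
    rw [cutCard, Finset.card_filter, Nat.cast_sum, Finset.mul_sum]
    refine Finset.sum_congr rfl fun e _ => ?_
    simp [Set.indicator_apply]
  have h2 : mass z Set.univ = mass z {S | ∃ v ∈ S, v ∈ U} + mass z {S | S ⊆ Uᶜ} := by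
    simp only [mass, ← Finset.sum_add_distrib]
    refine Finset.sum_congr rfl fun S _ => ?_
    have : S ⊆ Uᶜ ↔ ¬ ∃ v ∈ S, v ∈ U := by
      simp [Finset.subset_iff]
    by_cases hS : ∃ v ∈ S, v ∈ U <;> simp [this, hS]
  have h3 := mass_univ_le hz hr hT'
  have h4 := mass_compl_eq hz hF hTr
  have h5 := weight_eq_sum hU π
  have h6 := Finset.sum_compl_add_sum U π
  have h7 : mass z {S | ∃ v ∈ S, v ∈ U} ≤ length c T' - weight π T' + weight π T := by linarith
  have h8 := mul_le_mul_of_nonneg_left h7 (factor_pos r).le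
  linarith

end Guarantee

/-! ### Existence of an output, and its being a tree. -/

section Output

variable {V : Type*} [Fintype V] [DecidableEq V]
  {G : SimpleGraph V} {r : V} {c : Sym2 V → ℝ} {π : V → ℝ} {q : GWState V}
  {z : Finset V → ℝ} {F : Finset (Sym2 V)}

/-- With no active component, unlabelled vertices lie in the component of the root, and each label
stays within one component. Hence pruning minimises over a nonempty family. -/
theorem pruneFeasible_self (h : DualInvariant G r c π q z) (ha : q.active = ∅) :
    PruneFeasible r q q.F := by
  obtain ⟨R, hR, hrR⟩ := h.cover r
  have hmem : ∀ v, v ∈ R → ConnectedToRoot r q.F v := fun v hv => h.reach R hR r hrR v hv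
  have hconn : ∀ v, ConnectedToRoot r q.F v → v ∈ R := by
    intro v hv
    by_contra h0
    obtain ⟨e, he, hx⟩ := exists_crosses_of_reachable hv hrR h0
    exact h.F_inside e he R hR hx
  refine ⟨le_rfl, fun v hv => ?_, fun v u C D hv hu hCD hvr => ?_⟩
  · obtain ⟨C, hC, hvC⟩ := h.cover v
    by_cases hr : r ∈ C
    · exact hmem v (h.eq_of_mem C hC R hR r hr hrR ▸ hvC)
    · exact (h.label_inactive C hC (by simp [ha]) hr v hvC hv).elim
  · obtain ⟨E, hE, huE⟩ := h.cover u
    have h1 := h.label_sub u D hu E hE huE (hCD (h.label_mem v C hv))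
    exact hmem u (h.eq_of_mem E hE R hR v h1 (hconn v hvr) ▸ huE)

/-- Edges that are not connected to the root can be removed. -/
theorem connected_of_minimal (hF : PruneFeasible r q F)
    (hmin : ∀ F', PruneFeasible r q F' → F.card ≤ F'.card) {u v : V} (he : s(u, v) ∈ F)
    (huv : u ≠ v) : ConnectedToRoot r F u := by
  classical
  by_contra hu
  have hiff : ∀ x, ConnectedToRoot r (F.erase s(u, v)) x ↔ ConnectedToRoot r F x := by
    intro x
    constructor
    · exact fun hx => hx.mono (SimpleGraph.fromEdgeSet_mono (by simp))
    · intro hx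
      rw [ConnectedToRoot, SimpleGraph.reachable_iff_reflTransGen] at hx
      induction hx with
      | refl => exact SimpleGraph.Reachable.refl _
      | @tail a b hra hab ih =>
        refine SimpleGraph.Reachable.trans ih (SimpleGraph.Adj.reachable ?_)
        rw [SimpleGraph.fromEdgeSet_adj] at hab ⊢
        refine ⟨Finset.mem_erase.2 ⟨fun h0 => ?_, hab.1⟩, hab.2⟩
        rw [← SimpleGraph.reachable_iff_reflTransGen] at hra
        rcases Sym2.eq_iff.1 h0 with ⟨rfl, rfl⟩ | ⟨rfl, rfl⟩
        · exact hu hra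
        · refine hu (hra.trans (SimpleGraph.Adj.reachable ?_))
          rw [SimpleGraph.fromEdgeSet_adj]
          exact hab
  have hfeas : PruneFeasible r q (F.erase s(u, v)) := by
    refine ⟨(Finset.erase_subset _ _).trans hF.1, fun x hx => (hiff x).2 (hF.2.1 x hx),
      fun x w C D hx hw hCD hxr => (hiff w).2 (hF.2.2 x w C D hx hw hCD ((hiff x).1 hxr))⟩
  have h1 := hmin _ hfeas
  have h2 := Finset.card_erase_add_one he
  omega

theorem exists_isGWOutput (r : V) (hc : ∀ e ∈ G.edgeSet, 0 ≤ c e) (hπ : ∀ v, 0 ≤ π v) :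
    ∃ T : G.Subgraph, IsGWOutput G r c π T := by
  classical
  obtain ⟨q, hrun, ha⟩ := exists_run_to_inactive G r c π (GWState.init r)
  obtain ⟨z, hz⟩ := (DualInvariant.init (r := r) hc hπ).exists_of_run hrun
  obtain ⟨F, hF, hmin⟩ := Set.exists_min_image {F | PruneFeasible r q F} Finset.card
    (Set.toFinite _) ⟨q.F, pruneFeasible_self hz ha⟩
  have hadj : ∀ {u v}, s(u, v) ∈ F → G.Adj u v := fun he => hz.F_edge _ (hF.1 he)
  refine ⟨{ verts := {v | ConnectedToRoot r F v}
            Adj := fun u v => s(u, v) ∈ F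
            adj_sub := hadj
            edge_vert := fun he => connected_of_minimal hF hmin he (hadj he).ne
            symm := ⟨fun u v he => by rwa [Sym2.eq_swap]⟩ },
    q, F, hrun, ha, hF, hmin, rfl, ?_⟩
  ext e
  induction e using Sym2.ind with
  | _ i j => rfl

theorem crossing_init (hF : ∀ e ∈ F, ¬ e.IsDiag) : crossing (GWState.init r) F = F := by
  refine Finset.ext fun e => mem_crossing.trans (and_iff_left_of_imp fun he => ?_)
  induction e using Sym2.ind with
  | _ i j =>
  refine ⟨{i}, by simp [GWState.init], i, j, rfl, by simp, ?_⟩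
  rw [Finset.mem_singleton]
  rintro rfl
  exact hF _ he rfl

theorem card_meeting_init (T : Finset V) :
    (meeting (GWState.init r).comps T).card ≤ T.card := by
  classical
  refine (Finset.card_le_card (t := T.image fun v => {v}) fun C hC => ?_).trans
    Finset.card_image_le
  obtain ⟨hC, v, hv, hvT⟩ := mem_meeting.1 hC
  obtain ⟨u, -, rfl⟩ := Finset.mem_image.1 hC
  obtain rfl := Finset.mem_singleton.1 hv
  exact Finset.mem_image_of_mem _ hvT

/-- In the initial state all components are singletons, so the forest count there reads `|F| + 1 ≤
|U|`; for a connected graph this is the criterion for a tree. -/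
theorem isRootedSubtree_of_isGWOutput (hc : ∀ e ∈ G.edgeSet, 0 ≤ c e) (hπ : ∀ v, 0 ≤ π v)
    {T : G.Subgraph} (hT : IsGWOutput G r c π T) : IsRootedSubtree r T := by
  classical
  obtain ⟨q, F, hrun, -, hF, hmin, hV, hE⟩ := hT
  obtain ⟨U, hU⟩ := exists_finset_verts T
  have hr : r ∈ T.verts := by
    rw [hV]
    exact SimpleGraph.Reachable.refl _
  refine ⟨hr, ?_⟩
  have h0 := DualInvariant.init (r := r) hc hπ
  have hcard := card_crossing_add_one_le h0 hrun hF.1 (mem_of_isGWOutput hU hE)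
    (by rw [← Finset.mem_coe, ← hU]; exact hr)
  rw [crossing_init fun e he => G.not_isDiag_of_mem_edgeSet
    (T.edgeSet_subset (hE ▸ he : e ∈ T.edgeSet))] at hcard
  have hcard' := hcard.trans (card_meeting_init U)
  have hreach : ∀ v, ConnectedToRoot r F v → ∃ hv : v ∈ T.verts,
      T.coe.Reachable ⟨r, hr⟩ ⟨v, hv⟩ := by
    intro v hv
    rw [ConnectedToRoot, SimpleGraph.reachable_iff_reflTransGen] at hv
    induction hv with
    | refl => exact ⟨hr, SimpleGraph.Reachable.refl _⟩
    | @tail a b _ hab ih =>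
      obtain ⟨ha, h1⟩ := ih
      rw [SimpleGraph.fromEdgeSet_adj, ← hE] at hab
      have hadj : T.Adj a b := hab.1
      exact ⟨hadj.snd_mem, h1.trans (SimpleGraph.Adj.reachable hadj.coe)⟩
  have hconn : T.coe.Connected := by
    have : Nonempty T.verts := ⟨⟨r, hr⟩⟩
    refine ⟨fun u v => ?_⟩
    have key : ∀ w : T.verts, T.coe.Reachable ⟨r, hr⟩ w := fun w =>
      (hreach w.1 (hV.subset w.2)).2
    exact (key u).symm.trans (key v)
  refine SimpleGraph.isTree_iff_connected_and_card.2 ⟨hconn, le_antisymm ?_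
    hconn.card_vert_le_card_edgeSet_add_one⟩
  have h1 : Nat.card T.verts = U.card := by
    rw [hU]
    simp
  have h2 : Nat.card T.coe.edgeSet ≤ F.card := by
    have hf : ∀ e : T.coe.edgeSet, Sym2.map Subtype.val e.1 ∈ (F : Set (Sym2 V)) := by
      rintro ⟨e, he⟩
      rw [← hE]
      induction e using Sym2.ind with
      | _ i j => exact he
    have h3 := Nat.card_le_card_of_injective
      (fun e : T.coe.edgeSet => (⟨_, hf e⟩ : (F : Set (Sym2 V)))) fun a b hab =>
        Subtype.ext (Sym2.map.injective Subtype.val_injective (congrArg Subtype.val hab))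
    simpa using h3
  omega

end Output

/-! ### The parametric search: bounds, progress and termination. -/

section Search

variable {V : Type*} [Fintype V] [DecidableEq V]
  {G : SimpleGraph V} {r : V} {p : V → ℝ} {len : Sym2 V → ℝ}

theorem length_nonneg (hlen : ∀ e ∈ G.edgeSet, 0 < len e) (T : G.Subgraph) :
    0 ≤ length len T := by
  obtain ⟨E, hE⟩ := exists_finset_edgeSet T
  rw [length_eq_sum hE]
  exact Finset.sum_nonneg fun e he => (hlen e (T.edgeSet_subset (hE ▸ he))).le

theorem weight_nonneg (hp : ∀ v, 0 ≤ p v) (T : G.Subgraph) : 0 ≤ weight p T := by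
  obtain ⟨U, hU⟩ := exists_finset_verts T
  rw [weight_eq_sum hU]
  exact Finset.sum_nonneg fun v _ => hp v

theorem length_mul (a : ℝ) (T : G.Subgraph) :
    length (fun e => a * len e) T = a * length len T := by
  obtain ⟨E, hE⟩ := exists_finset_edgeSet T
  rw [length_eq_sum hE, length_eq_sum hE, Finset.mul_sum]

/-- In a connected graph every vertex but the root has a neighbour that is closer to the root. -/
theorem exists_parent {W : Type*} {H : SimpleGraph W} (hH : H.Connected) (r v : W) (hv : v ≠ r) :
    ∃ u, H.Adj v u ∧ H.dist u r < H.dist v r := by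
  obtain ⟨w, hw⟩ := hH.exists_walk_length_eq_dist v r
  cases w with
  | nil => exact (hv rfl).elim
  | @cons _ u _ hadj w' =>
    refine ⟨u, hadj, (SimpleGraph.dist_le w').trans_lt ?_⟩
    rw [SimpleGraph.Walk.length_cons] at hw
    omega

/-- A bound on the weight-to-length ratios of single edges bounds all connected subgraphs. -/
theorem weight_le_of_edge_bound (hpr : p r = 0) (hlen : ∀ e ∈ G.edgeSet, 0 < len e) {b : ℝ}
    (hb0 : 0 ≤ b) (hb : ∀ v w, G.Adj v w → p v / len s(v, w) ≤ b) {T : G.Subgraph}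
    (hr : r ∈ T.verts) (hT : T.coe.Connected) : weight p T ≤ b * length len T := by
  classical
  obtain ⟨U, hU⟩ := exists_finset_verts T
  obtain ⟨E, hE⟩ := exists_finset_edgeSet T
  -- `D` is the distance to the root inside `T`, and `u` is a parent of `v`; the value 0 off `T` is
  -- never used. Each non-root vertex will be charged to its parent edge.
  have hpar : ∃ D : V → ℕ, ∀ v, ∃ u, v ∈ U.erase r → T.Adj v u ∧ D u < D v := by
    refine ⟨fun v => if h : v ∈ T.verts then T.coe.dist ⟨v, h⟩ ⟨r, hr⟩ else 0, fun v => ?_⟩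
    by_cases hv : v ∈ U.erase r
    · obtain ⟨hvr, hvU⟩ := Finset.mem_erase.1 hv
      have hvT : v ∈ T.verts := by
        rw [hU]
        exact hvU
      obtain ⟨⟨u, hu⟩, hadj, hlt⟩ := exists_parent hT ⟨r, hr⟩ ⟨v, hvT⟩
        fun h0 => hvr (congrArg Subtype.val h0)
      refine ⟨u, fun _ => ⟨hadj, ?_⟩⟩
      simpa [hu, hvT] using hlt
    · exact ⟨v, fun h0 => (hv h0).elim⟩
  obtain ⟨D, hD⟩ := hpar
  choose f hf using hD
  have hinj : Set.InjOn (fun v => s(v, f v)) (U.erase r : Finset V) := by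
    intro v hv w hw hvw
    rcases Sym2.eq_iff.1 hvw with ⟨h0, -⟩ | ⟨h0, h1⟩
    · exact h0
    -- Two vertices cannot be parents of each other, since `D` would decrease both ways.
    · have h2 := (hf v hv).2
      have h3 := (hf w hw).2
      rw [h1] at h2
      rw [← h0] at h3
      omega
  rw [weight_eq_sum hU, length_eq_sum hE, ← Finset.sum_erase U hpr]
  calc ∑ v ∈ U.erase r, p v ≤ ∑ v ∈ U.erase r, b * len s(v, f v) := by
        refine Finset.sum_le_sum fun v hv => ?_
        have hadj := (hf v hv).1.adj_sub
        exact (div_le_iff₀ (hlen _ hadj)).1 (hb v (f v) hadj)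
    _ = b * ∑ e ∈ (U.erase r).image fun v => s(v, f v), len e := by
        rw [Finset.sum_image hinj, Finset.mul_sum]
    _ ≤ b * ∑ e ∈ E, len e := by
        refine mul_le_mul_of_nonneg_left (Finset.sum_le_sum_of_subset_of_nonneg ?_ ?_) hb0
        · intro e he
          obtain ⟨v, hv, rfl⟩ := Finset.mem_image.1 he
          rw [← Finset.mem_coe, ← hE]
          exact (hf v hv).1
        · exact fun e he _ => (hlen e (T.edgeSet_subset (hE ▸ he))).le

/-- The invariant of the parametric search. -/
structure SearchInvariant (r : V) (p : V → ℝ) (len : Sym2 V → ℝ) (s : SearchState G) : Prop where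
  rooted : IsRootedSubtree r s.tree
  pos : 0 < length len s.tree
  α_eq : s.α = factor r * density p len s.tree
  bound : ∀ T : G.Subgraph, r ∈ T.verts → T.coe.Connected → weight p T ≤ s.β * length len T

namespace SearchInvariant

variable {s s' : SearchState G} {ε : ℝ}

theorem of_initial (hp : ∀ v, 0 ≤ p v) (hpr : p r = 0) (hlen : ∀ e ∈ G.edgeSet, 0 < len e)
    (h : SearchInitial r p len s) : SearchInvariant r p len s := by
  obtain ⟨h1, h2, h3, ⟨v, w, hvw, hβ⟩, h5⟩ := h
  refine ⟨h1, h2, h3, fun T hr hT => weight_le_of_edge_bound hpr hlen ?_ ?_ hr hT⟩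
  · rw [hβ]
    exact div_nonneg (hp v) (hlen _ hvw).le
  · exact fun v w hvw => h5 ⟨v, w, hvw, rfl⟩

theorem α_nonneg [Nontrivial V] (h : SearchInvariant r p len s) (hp : ∀ v, 0 ≤ p v) :
    0 ≤ s.α := by
  rw [h.α_eq]
  exact mul_nonneg (factor_pos r).le (div_nonneg (weight_nonneg hp _) h.pos.le)

/-- The loop condition with `α ≥ 0` forces `β > 0`. Positivity of the guess keeps the edge costs
nonnegative, as the dual analysis requires. -/
theorem guess_pos [Nontrivial V] (h : SearchInvariant r p len s) (hp : ∀ v, 0 ≤ p v)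
    (hε : 0 < ε) (hlt : (1 + ε) * s.α < s.β) : 0 < s.guess := by
  have h1 := h.α_nonneg hp
  have h2 : 0 ≤ (1 + ε) * s.α := mul_nonneg (by linarith) h1
  rw [SearchState.guess]
  linarith

/-- If the test succeeds, the guarantee makes the guess an upper bound for all competitors. If it
fails, the new `α` exceeds the guess. Either way one end moves at least to the midpoint. -/
theorem step [Nontrivial V] (h : SearchInvariant r p len s) (hp : ∀ v, 0 ≤ p v)
    (hlen : ∀ e ∈ G.edgeSet, 0 < len e) (hε : 0 < ε)
    (hs : SearchStep r p len ε s s') :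
    SearchInvariant r p len s' ∧ s'.β - s'.α ≤ (s.β - s.α) / 2 := by
  obtain ⟨hlt, T, hT, hcase⟩ := hs
  have hg := h.guess_pos hp hε hlt
  have hc : ∀ e ∈ G.edgeSet, 0 ≤ s.guess * len e := fun e he => (mul_pos hg (hlen e he)).le
  have hf := factor_pos r
  rcases hcase with ⟨hle, rfl⟩ | ⟨hgt, rfl⟩
  · refine ⟨⟨h.rooted, h.pos, h.α_eq, fun T' hr hT' => ?_⟩, ?_⟩
    · have h1 := gw_guarantee hc hp hT hr hT'
      rw [length_mul, length_mul] at h1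
      have h2 : 0 ≤ factor r * (s.guess * length len T' - weight p T') := by linarith
      exact sub_nonneg.1 (nonneg_of_mul_nonneg_right h2 hf)
    · simp only [SearchState.guess]
      linarith
  · have hrt := isRootedSubtree_of_isGWOutput hc hp hT
    have hpos : 0 < length len T := by
      -- A tree of length 0 has weight at most 0 by the bound for `β`, so it cannot fail the test.
      refine (length_nonneg hlen T).lt_of_ne fun h0 => ?_
      have h1 := h.bound T hrt.1 hrt.2.connected
      rw [← h0, mul_zero] at h1 hgt
      exact hgt.not_ge (mul_nonpos_of_nonneg_of_nonpos hf.le h1)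
    refine ⟨⟨hrt, hpos, rfl, h.bound⟩, ?_⟩
    have h1 : s.guess < factor r * density p len T := by
      rw [density, ← mul_div_assoc, lt_div_iff₀ hpos]
      exact hgt
    simp only [SearchState.guess] at h1
    simp only
    linarith

theorem of_run [Nontrivial V] (h : SearchInvariant r p len s) (hp : ∀ v, 0 ≤ p v)
    (hlen : ∀ e ∈ G.edgeSet, 0 < len e) (hε : 0 < ε)
    (hs : Relation.ReflTransGen (SearchStep r p len ε) s s') : SearchInvariant r p len s' := by
  induction hs with
  | refl => exact h
  | tail _ hstep ih => exact (ih.step hp hlen hε hstep).1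

theorem exists_step [Nontrivial V] (h : SearchInvariant r p len s) (hp : ∀ v, 0 ≤ p v)
    (hlen : ∀ e ∈ G.edgeSet, 0 < len e) (hε : 0 < ε) (hs : ¬ SearchDone ε s) :
    ∃ s', SearchStep r p len ε s s' := by
  have hlt := not_not.1 hs
  have hg := h.guess_pos hp hε hlt
  obtain ⟨T, hT⟩ := exists_isGWOutput (G := G) (c := fun e => s.guess * len e) r
    (fun e he => (mul_pos hg (hlen e he)).le) hp
  rcases le_or_gt (factor r * weight p T) (s.guess * length len T) with h0 | h0
  · exact ⟨_, hlt, T, hT, Or.inl ⟨h0, rfl⟩⟩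
  · exact ⟨_, hlt, T, hT, Or.inr ⟨h0, rfl⟩⟩

end SearchInvariant

theorem not_exists_infinite_search [Nontrivial V] (hG : G.Connected) (hp : ∀ v, 0 ≤ p v)
    (hpr : p r = 0) (hlen : ∀ e ∈ G.edgeSet, 0 < len e) {ε : ℝ} (hε : 0 < ε)
    {s : SearchState G} (hs : SearchInitial r p len s) :
    ¬ ∃ run : ℕ → SearchState G, run 0 = s ∧ ∀ k, SearchStep r p len ε (run k) (run (k + 1)) := by
  classical
  rintro ⟨run, h0, hrun⟩
  have hinv : ∀ k, SearchInvariant r p len (run k) ∧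
      (run k).β - (run k).α ≤ ((1 : ℝ) / 2) ^ k * (s.β - s.α) := by
    intro k
    induction k with
    | zero =>
      rw [h0]
      exact ⟨.of_initial hp hpr hlen hs, by simp⟩
    | succ k ih =>
      obtain ⟨h1, h2⟩ := ih.1.step hp hlen hε (hrun k)
      refine ⟨h1, ?_⟩
      rw [pow_succ]
      linarith [ih.2]
  have hlt : ∀ k, (1 + ε) * (run k).α < (run k).β := fun k => (hrun k).1
  have hα : ∀ k, 0 ≤ (run k).α := fun k => (hinv k).1.α_nonneg hp
  -- Entering the loop once makes the initial `β` positive, so some vertex attaining it has positive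
  -- weight.
  have hW : 0 < weight p (⊤ : G.Subgraph) := by
    obtain ⟨v, w, hvw, hβ⟩ := hs.2.2.2.1
    have h1 : 0 < p v / len s(v, w) := by
      have h2 := hlt 0
      have h3 := mul_nonneg (by linarith : 0 ≤ 1 + ε) (hα 0)
      rw [h0] at h2 h3
      rw [← hβ]
      linarith
    have h2 : 0 < p v := by
      by_contra h3
      rw [le_antisymm (not_lt.1 h3) (hp v), zero_div] at h1
      exact h1.false
    rw [weight_eq_sum (U := Finset.univ) (by simp)]
    exact h2.trans_le (Finset.single_le_sum (fun v _ => hp v) (Finset.mem_univ v))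
  have hL := length_nonneg hlen (⊤ : G.Subgraph)
  have hgap : 0 ≤ s.β - s.α := by
    have h2 := hlt 0
    have h3 := mul_nonneg hε.le (hα 0)
    rw [h0] at h2 h3
    linarith
  have hM : 0 ≤ (ε + 1) * (s.β - s.α) * length len (⊤ : G.Subgraph) :=
    mul_nonneg (mul_nonneg (by linarith) hgap) hL
  obtain ⟨k, hk⟩ := exists_pow_lt_of_lt_one
    -- The summand 1 keeps the denominator positive even if the product vanishes.
    (show 0 < ε * weight p (⊤ : G.Subgraph) /
      ((ε + 1) * (s.β - s.α) * length len (⊤ : G.Subgraph) + 1) from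
      div_pos (mul_pos hε hW) (by linarith)) (show (1 : ℝ) / 2 < 1 by norm_num)
  rw [lt_div_iff₀ (by linarith)] at hk
  have h1 := (hinv k).1.bound ⊤ (Set.mem_univ r)
    (SimpleGraph.Subgraph.topIso.connected_iff.2 hG)
  -- The loop condition is equivalent to `ε β < (1 + ε) (β - α)`, so the halving gap drags `β` to 0.
  have h2 : ε * (run k).β ≤ (ε + 1) * ((1 / 2) ^ k * (s.β - s.α)) := by
    have h3 := mul_le_mul_of_nonneg_left (hinv k).2 (by linarith : 0 ≤ ε + 1)
    have h4 := hlt k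
    linarith
  have h3 := mul_le_mul_of_nonneg_left h1 hε.le
  have h4 := mul_le_mul_of_nonneg_right h2 hL
  have h5 : 0 < ((1 : ℝ) / 2) ^ k := by positivity
  linarith

theorem exists_searchInitial [Nontrivial V] (hG : G.Connected) (r : V) (p : V → ℝ)
    (hlen : ∀ e ∈ G.edgeSet, 0 < len e) :
    ∃ s : SearchState G, SearchInitial r p len s := by
  obtain ⟨v, hv⟩ := hG.preconnected.exists_adj_of_nontrivial r
  have hfin : {x | ∃ v w, G.Adj v w ∧ x = p v / len s(v, w)}.Finite := by
    refine (Set.finite_range fun x : V × V => p x.1 / len s(x.1, x.2)).subset ?_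
    rintro _ ⟨v, w, -, rfl⟩
    exact ⟨(v, w), rfl⟩
  obtain ⟨b, hb⟩ := hfin.isCompact.exists_isGreatest ⟨_, r, v, hv, rfl⟩
  refine ⟨⟨factor r * (weight p (G.subgraphOfAdj hv) / length len (G.subgraphOfAdj hv)), b,
    G.subgraphOfAdj hv⟩, ⟨by simp, SimpleGraph.IsTree.coe_subgraphOfAdj hv⟩,
    ?_, rfl, hb⟩
  rw [length_eq_sum (F := {s(r, v)}) (by simp), Finset.sum_singleton]
  exact hlen _ hv

theorem exists_isGreatest_densities (T : G.Subgraph) (hT : IsRootedSubtree r T)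
    (hpos : 0 < length len T) : ∃ x, IsGreatest (densities G r p len) x := by
  have hfin : (densities G r p len).Finite := by
    refine (Set.finite_range fun T : G.Subgraph => density p len T).subset ?_
    rintro _ ⟨T, -, -, rfl⟩
    exact ⟨T, rfl⟩
  exact hfin.isCompact.exists_isGreatest ⟨_, T, hT, hpos, rfl⟩

end Search

end MDSP

/-! ### The main theorem. -/

theorem mainTheorem3 {V : Type*} [Fintype V] [DecidableEq V] [Nontrivial V]
    (G : SimpleGraph V) (hG : G.Connected) (r : V)
    (p : V → ℝ) (hp : ∀ v, 0 ≤ p v) (hpr : p r = 0)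
    (len : Sym2 V → ℝ) (hlen : ∀ e ∈ G.edgeSet, 0 < len e)
    (ε : ℝ) (hε : 0 < ε) :
    -- the search can be started, and every execution of it terminates
    (∃ s : MDSP.SearchState G, MDSP.SearchInitial r p len s) ∧
    (∀ s : MDSP.SearchState G, MDSP.SearchInitial r p len s →
      MDSP.AlwaysTerminates (MDSP.SearchStep r p len ε) (MDSP.SearchDone ε) s) ∧
    -- so does every call of the Goemans–Williamson algorithm that it makes
    (∀ s : MDSP.SearchState G, MDSP.SearchReachable r p len ε s → ¬ MDSP.SearchDone ε s →
      MDSP.AlwaysTerminates (MDSP.GWStep G r (fun e => s.guess * len e) p)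
        (fun q => q.active = ∅) (MDSP.GWState.init r)) ∧
    -- every tree that is returned has the claimed density
    (∀ T : G.Subgraph, MDSP.SearchReturns r p len ε T →
      MDSP.IsRootedSubtree r T ∧ 0 < MDSP.length len T ∧
      ∃ ρmax : ℝ, IsGreatest (MDSP.densities G r p len) ρmax ∧
        ρmax ≤ (1 + ε) * (2 - 1 / ((Finset.univ.erase r).card : ℝ)) * MDSP.density p len T) := by
  refine ⟨MDSP.exists_searchInitial hG r p hlen, fun s hs => ⟨fun s' hs' => ?_, ?_⟩,
    fun s _ _ => MDSP.alwaysTerminates_gw G r _ p _, ?_⟩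
  · exact or_iff_not_imp_left.2
      (((MDSP.SearchInvariant.of_initial hp hpr hlen hs).of_run hp hlen hε hs').exists_step
        hp hlen hε)
  · exact MDSP.not_exists_infinite_search hG hp hpr hlen hε hs
  · rintro _ ⟨s, ⟨s₀, hs₀, hrun⟩, hdone, rfl⟩
    have h := (MDSP.SearchInvariant.of_initial hp hpr hlen hs₀).of_run hp hlen hε hrun
    refine ⟨h.rooted, h.pos, ?_⟩
    obtain ⟨x, hx⟩ := MDSP.exists_isGreatest_densities (p := p) s.tree h.rooted h.pos
    refine ⟨x, hx, ?_⟩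
    obtain ⟨T, hT, hpos, rfl⟩ := hx.1
    -- Here `T` is a densest tree: its density is at most `β`, and at exit `β ≤ (1 + ε) α`.
    have h1 := h.bound T hT.1 hT.2.connected
    have h2 : MDSP.density p len T ≤ s.β := (div_le_iff₀ hpos).2 h1
    have h3 := not_lt.1 hdone
    rw [h.α_eq, MDSP.factor, ← mul_assoc] at h3
    exact h2.trans h3
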